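/- **Conventions.** All Hilbert spaces are finite-dimensional complex with fixed canonical bases; $|A|$ is the dimension of the system $A$, and $A'$ is a copy of $A$. Logarithms are to base $2$. For a matrix $M$ put $\|M\|_1=\operatorname{tr}\sqrt{M^\dagger M}$. For an operator $U$ on $A$ and an operator $X$ on $AR$, $U\cdot X=(U\otimes\mathbb I^R)X(U\otimes\mathbb I^R)^\dagger$; a linear map applied to an operator on a larger system acts as the identity on the remaining factor. Reduced operators are partial traces, e.g. $\rho^R=\operatorname{tr}_A\rho^{AR}$. Let $\Phi^{AA'}=|\Phi\rangle\langle\Phi|$ with $|\Phi\rangle=|A|^{-1/2}\sum_i|i\rangle^A|i\rangle^{A'}$. For positive semidefinite $\rho,\sigma$ of trace at most $1$ let $F(\rho,\sigma)=\|\sqrt\rho\sqrt\sigma\|_1$ and $d_F(\rho,\sigma)=\sqrt{1-F(\rho,\sigma)^2}$. For positive semidefinite $\rho^{AB}$ define $$H_2(A|B)_\rho=-\log\inf_{\sigma^B}\operatorname{tr}\Big[\big((\mathbb I^A\otimes\sigma^B)^{-1/2}\rho^{AB}\big)^2\Big],$$ the infimum being over positive definite density operators $\sigma^B$, and, for $\rho^{AB}$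 of trace at most $1$, $$H_2^{\varepsilon}(A|B)_\rho=\sup\{H_2(A|B)_\sigma:\ \sigma^{AB}\ge 0,\ \operatorname{tr}\sigma\le1,\ d_F(\rho,\sigma)\le\varepsilon\}.$$ These quantities take values in $[-\infty,\infty]$, with $-\log 0=+\infty$, $\sup\emptyset=-\infty$, $\inf\emptyset=+\infty$, $2^{-\infty}=0$, $2^{\infty}=\infty$, and $\infty-\infty=-\infty$ (this last case can arise below only if $E$ is zero-dimensional, when the left-hand side is $0$). **Theorem.** Let $\rho^{AR}$ be a density operator, let $\mathcal T^{A\to E}$ be a completely positive linear map, and suppose that $\omega^{A'E}:=(\mathcal T\otimes\mathbb I^{A'})(\Phi^{AA'})$ satisfies $\operatorname{tr}\omega\le 1$ (for instance, that $\omega$ is a density operator). Let $\varepsilon>0$. Then $$\int_{\mathbb U(A)}\big\|\mathcal T(U\cdot\rho^{AR})-\omega^E\otimes\rho^R\big\|_1\,dU\ \le\ 2^{-\frac12H_2^{\varepsilon}(A'|E)_\omega-\frac12H_2^{\varepsilon}(A|R)_\rho}+8\varepsilon,$$ where $dU$ is the normalised Haar measure on the unitary group of $A$. -/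

import Mathlib

open scoped Kronecker MatrixOrder ComplexOrder ENNReal Matrix

noncomputable section

namespace Decoupling

/-! Quantum systems are represented by finite index types: the system `A` has the Hilbert space
`ℂ^A` with its canonical basis, `AB` is indexed by `A × B`, and operators are matrices. -/

section Operators

variable {A B E R m n : Type*} [Fintype A] [DecidableEq A] [Fintype B] [DecidableEq B]
  [Fintype E] [DecidableEq E] [Fintype R] [DecidableEq R]
  [Fintype m] [DecidableEq m] [Fintype n] [DecidableEq n]

/-- Density operators: positive semidefinite with trace one. -/
def IsDensity (ρ : Matrix n n ℂ) : Prop :=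
  ρ.PosSemidef ∧ ρ.trace = 1

/-- The trace norm `‖M‖₁ = tr √(M† M)`. -/
def traceNorm (M : Matrix m n ℂ) : ℝ :=
  (CFC.sqrt (Mᴴ * M)).trace.re

/-- The fidelity `F(ρ, σ) = ‖√ρ √σ‖₁`. -/
def fidelity (ρ σ : Matrix n n ℂ) : ℝ :=
  traceNorm (CFC.sqrt ρ * CFC.sqrt σ)

/-- The fidelity distance `d_F(ρ, σ) = √(1 - F(ρ, σ)²)`. -/
def fidelityDist (ρ σ : Matrix n n ℂ) : ℝ :=
  Real.sqrt (1 - fidelity ρ σ ^ 2)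

/-- The partial trace over the first factor, `M^{AB} ↦ M^B = tr_A M`. -/
def traceFst (M : Matrix (A × B) (A × B) ℂ) : Matrix B B ℂ :=
  Matrix.of fun b b' => ∑ a, M (a, b) (a, b')

/-- The map `T ⊗ id_R` applied to an operator on `AR`: the `(r, s)` block of `X`, which is an
operator on `A`, is replaced by its image under `T`. -/
def applyFst (T : Matrix A A ℂ →ₗ[ℂ] Matrix E E ℂ) (X : Matrix (A × R) (A × R) ℂ) :
    Matrix (E × R) (E × R) ℂ :=
  Matrix.of fun p q => T (Matrix.of fun a b => X (a, p.2) (b, q.2)) p.1 q.1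

/-- `U · X = (U ⊗ 1_R) X (U ⊗ 1_R)†` for an operator `U` on `A` and an operator `X` on `AR`. -/
def conjFst (U : Matrix A A ℂ) (X : Matrix (A × R) (A × R) ℂ) : Matrix (A × R) (A × R) ℂ :=
  (U ⊗ₖ (1 : Matrix R R ℂ)) * X * (U ⊗ₖ (1 : Matrix R R ℂ))ᴴ

/-- The unit vector `|Φ⟩ = |A|^{-1/2} ∑ᵢ |i⟩|i⟩` of `AA'`, where `A'` is a copy of `A`. -/
def maxEntangledVec (A : Type*) [Fintype A] [DecidableEq A] : A × A → ℂ :=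
  fun p => if p.1 = p.2 then ((Real.sqrt (Fintype.card A))⁻¹ : ℝ) else 0

/-- The maximally entangled state `Φ^{AA'} = |Φ⟩⟨Φ|`. -/
def maxEntangled (A : Type*) [Fintype A] [DecidableEq A] : Matrix (A × A) (A × A) ℂ :=
  Matrix.vecMulVec (maxEntangledVec A) (star (maxEntangledVec A))

/-- The operator `ω^{A'E} = (T ⊗ id_{A'})(Φ^{AA'})`, with the factors listed in the order
`A'`, `E`. -/
def choiState (T : Matrix A A ℂ →ₗ[ℂ] Matrix E E ℂ) : Matrix (A × E) (A × E) ℂ :=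
  (applyFst T (maxEntangled A)).submatrix Prod.swap Prod.swap

end Operators

section CompletePositivity

open scoped Matrix.Norms.L2Operator

/-- Complete positivity of a linear map between matrix algebras, regarded as C⋆-algebras with the
operator norm and the positive semidefinite order. -/
def IsCompletelyPositive {A E : Type*} [Fintype A] [DecidableEq A] [Fintype E] [DecidableEq E]
    (T : Matrix A A ℂ →ₗ[ℂ] Matrix E E ℂ) : Prop :=
  ∃ S : CompletelyPositiveMap (Matrix A A ℂ) (Matrix E E ℂ), S.toLinearMap = T

end CompletePositivity

section Entropy

variable {A B : Type*} [Fintype A] [DecidableEq A] [Fintype B] [DecidableEq B]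

/-- The logarithm to base two, with `log₂ 0 = -∞` and `log₂ ∞ = ∞`. -/
def log₂ (x : ℝ≥0∞) : EReal :=
  ENNReal.log x / (Real.log 2 : ℝ)

/-- The power `2 ^ x` of an extended real, with `2 ^ (-∞) = 0` and `2 ^ ∞ = ∞`. -/
def exp₂ (x : EReal) : ℝ≥0∞ :=
  EReal.exp (x * (Real.log 2 : ℝ))

/-- The conditional 2-entropy `H₂(A|B)_ρ`: minus the base two logarithm of the infimum of
`tr [((1 ⊗ σ)^{-1/2} ρ)²]` over the positive definite density operators `σ` on `B`. -/
def condTwoEntropy (ρ : Matrix (A × B) (A × B) ℂ) : EReal :=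
  -log₂ (⨅ σ ∈ {σ : Matrix B B ℂ | IsDensity σ ∧ σ.PosDef},
    ENNReal.ofReal
      ((((1 : Matrix A A ℂ) ⊗ₖ σ) ^ (-(1 / 2) : ℝ) * ρ) ^ 2).trace.re)

/-- The `ε`-ball around `ρ`: the positive semidefinite operators of trace at most one whose
fidelity distance from `ρ` is at most `ε`. -/
def smoothingBall {n : Type*} [Fintype n] [DecidableEq n] (ρ : Matrix n n ℂ) (ε : ℝ) :
    Set (Matrix n n ℂ) :=
  {σ | σ.PosSemidef ∧ σ.trace.re ≤ 1 ∧ fidelityDist ρ σ ≤ ε}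

/-- The smooth conditional 2-entropy `H₂^ε(A|B)_ρ`. -/
def smoothCondTwoEntropy (ε : ℝ) (ρ : Matrix (A × B) (A × B) ℂ) : EReal :=
  ⨆ σ ∈ smoothingBall ρ ε, condTwoEntropy σ

end Entropy

section Haar

variable (A : Type*) [Fintype A] [DecidableEq A]

instance instMeasurableSpaceUnitaryGroup : MeasurableSpace (Matrix.unitaryGroup A ℂ) :=
  borel _

instance instBorelSpaceUnitaryGroup : BorelSpace (Matrix.unitaryGroup A ℂ) :=
  ⟨rfl⟩

instance instCompactSpaceUnitaryGroup : CompactSpace (Matrix.unitaryGroup A ℂ) := by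
  refine (isCompact_iff_compactSpace (s := (Matrix.unitaryGroup A ℂ : Set (Matrix A A ℂ)))).mp ?_
  have hK : IsCompact (Set.univ.pi fun _ : A => Set.univ.pi fun _ : A =>
      Metric.closedBall (0 : ℂ) 1) :=
    isCompact_univ_pi fun _ => isCompact_univ_pi fun _ => isCompact_closedBall 0 1
  refine IsCompact.of_isClosed_subset hK ?_ ?_
  · have h : ((Matrix.unitaryGroup A ℂ : Submonoid (Matrix A A ℂ)) : Set (Matrix A A ℂ)) =
        {M | star M * M = 1} := by
      ext M
      exact Matrix.mem_unitaryGroup_iff'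
    rw [h]
    exact isClosed_eq (by fun_prop) continuous_const
  · intro U hU i _ j _
    simpa using entry_norm_bound_of_unitary hU i j

/-- The Haar measure on the unitary group of `ℂ^A`, normalised to total mass one. -/
def unitaryHaar : MeasureTheory.Measure (Matrix.unitaryGroup A ℂ) :=
  MeasureTheory.Measure.haarMeasure ⊤

end Haar

end Decoupling

end

open Decoupling

/-!
The theorem is the smoothed one-shot decoupling inequality, and its proof has two halves.

*Unsmoothed bound.* Write `T` for the map with Choi operator `ω` and `D(U) = T(U · ρ) - ω^E ⊗ ρ^R`
(`deviation`). For positive definite states `σ` on `E` and `ζ` on `R`, the Cauchy–Schwarz inequality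
bounds `‖D‖₁` by the Hilbert–Schmidt norm of `(σ ⊗ ζ)^{-1/4} D (σ ⊗ ζ)^{-1/4}`
(`traceNorm_sq_le_weighted`), and this operator is again the deviation of a pair, namely of
`ω̃ = σ^{-1/4} ω σ^{-1/4}` and `ρ̃ = ζ^{-1/4} ρ ζ^{-1/4}` (`kronecker_mul_deviation_mul`). The Haar
average of its square involves only second moments of the unitary group. These are determined by
the commutant of `U ⊗ U`: a bilinear form invariant under unitary conjugation is
`α tr X tr Y + β tr (X Y)` (`exists_eq_trace_mul_trace_add_trace_mul`). Invariance under the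
unitaries `(1 ± i H) / √2` with `H` a Hermitian involution already makes the form invariant under
every inner derivation, and this is a linear condition that matrix units solve. For the form
`tr (T X T Y)` positivity of `T` gives `α, β ≥ 0`, whence the average is at most
`tr ω̃² tr ρ̃²` (`integral_trace_deviation_sq_le`), which is the product of the two quantities
optimised in the conditional entropies.

*Smoothing.* If `ω'` and `ρ'` lie in the smoothing balls, the Fuchs–van de Graaf inequality
(`traceNorm_sub_le_two_mul_fidelityDist`) puts them within trace norm distance `2ε` of `ω` and `ρ`. The
deviation is bilinear in the pair, and for positive semidefinite operators its trace norm averages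
to at most `2 tr ω tr ρ`, since first moments of the Haar measure depolarise. Replacing `(ω, ρ)` by
`(ω', ρ')` therefore costs `2 · 2ε + 2 · 2ε = 8ε` (`lintegral_traceNorm_deviation_le`).

What remains is the passage to the infimum over all smoothing pairs in extended arithmetic. The
delicate case is an empty ball around `ω`, possible when `tr ω < 1`: there the first factor is `⊤`,
and the second must be shown not to vanish (`trace_re_sq_le_card_mul_weightedPurity`).
-/

set_option linter.unusedSectionVars false

namespace Decoupling

open MeasureTheory

/-! ### The trace norm and the fidelity distance -/

section TraceNorm
variable {n m : Type*} [Fintype n] [Fintype m]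

theorem trace_re_nonneg {P : Matrix n n ℂ} (hP : P.PosSemidef) : 0 ≤ P.trace.re :=
  (Complex.nonneg_iff.mp hP.trace_nonneg).1

theorem trace_im_eq_zero {P : Matrix n n ℂ} (hP : P.PosSemidef) : P.trace.im = 0 :=
  (Complex.nonneg_iff.mp hP.trace_nonneg).2.symm

theorem trace_conjTranspose_mul_self_re_nonneg (P : Matrix n m ℂ) :
    0 ≤ (Pᴴ * P).trace.re :=
  trace_re_nonneg (Matrix.posSemidef_conjTranspose_mul_self P)

/-- The Cauchy–Schwarz inequality for the Hilbert–Schmidt inner product. -/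
theorem trace_re_sq_le (P Q : Matrix n m ℂ) :
    (Pᴴ * Q).trace.re ^ 2 ≤ (Pᴴ * P).trace.re * (Qᴴ * Q).trace.re := by
  have key : ∀ t : ℝ, 0 ≤ (Pᴴ * P).trace.re * (t * t) + (2 * (Pᴴ * Q).trace.re) * t
      + (Qᴴ * Q).trace.re := by
    intro t
    have h := trace_conjTranspose_mul_self_re_nonneg ((t : ℂ) • P + Q)
    have hc : (Qᴴ * P).trace.re = (Pᴴ * Q).trace.re := by
      have : Qᴴ * P = (Pᴴ * Q)ᴴ := by simp
      rw [this, Matrix.trace_conjTranspose]; simp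
    simp only [Matrix.conjTranspose_add, Matrix.conjTranspose_smul, Matrix.add_mul, Matrix.mul_add,
      Matrix.smul_mul, Matrix.mul_smul, Matrix.trace_add, Matrix.trace_smul, Complex.add_re,
      smul_eq_mul, Complex.star_def, Complex.conj_ofReal, Complex.re_ofReal_mul, hc] at h
    linarith
  have := discrim_le_zero key
  rw [discrim] at this
  nlinarith

variable [DecidableEq n]

theorem traceNorm_eq_trace_abs (M : Matrix n n ℂ) : traceNorm M = (CFC.abs M).trace.re := rfl

theorem traceNorm_nonneg (M : Matrix n n ℂ) : 0 ≤ traceNorm M :=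
  trace_re_nonneg (Matrix.nonneg_iff_posSemidef.mp (CFC.sqrt_nonneg _))

/-- The Jordan decomposition of a Hermitian matrix realises its trace norm. -/
theorem exists_posSemidef_sub {H : Matrix n n ℂ} (hH : H.IsHermitian) :
    ∃ P N : Matrix n n ℂ, P.PosSemidef ∧ N.PosSemidef ∧ H = P - N ∧
      traceNorm H = P.trace.re + N.trace.re := by
  have hs : IsSelfAdjoint H := hH
  refine ⟨H⁺, H⁻, Matrix.nonneg_iff_posSemidef.mp (CFC.posPart_nonneg H),
    Matrix.nonneg_iff_posSemidef.mp (CFC.negPart_nonneg H),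
    (CFC.posPart_sub_negPart H hs).symm, ?_⟩
  rw [traceNorm_eq_trace_abs, ← CFC.posPart_add_negPart H hs, Matrix.trace_add, Complex.add_re]

/-- The sign of a Hermitian matrix, which realises its trace norm as a pairing. -/
theorem exists_sign {H : Matrix n n ℂ} (hH : H.IsHermitian) :
    ∃ S : Matrix n n ℂ, S.IsHermitian ∧ S * S = 1 ∧ traceNorm H = (S * H).trace.re := by
  have hs : IsSelfAdjoint H := hH
  let f : ℝ → ℝ := fun x => if 0 ≤ x then 1 else -1
  have hf : ContinuousOn f (spectrum ℝ H) := (Matrix.finite_real_spectrum).continuousOn _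
  refine ⟨cfc f H, cfc_predicate f H, ?_, ?_⟩
  · rw [← cfc_mul f f H hf hf, ← cfc_one ℝ H]
    refine cfc_congr fun x _ => ?_
    by_cases h : 0 ≤ x <;> simp [f, h]
  · have h1 : cfc f H * H = cfc (fun x => f x * x) H := by
      rw [cfc_mul f (fun x => x) H hf, cfc_id' ℝ H hs]
    rw [traceNorm_eq_trace_abs, CFC.abs_eq_cfc_norm H hs, h1]
    congr 3
    funext x
    by_cases h : 0 ≤ x
    · simp [f, h, abs_of_nonneg h]
    · simp [f, h, abs_of_neg (not_le.mp h)]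

theorem trace_mul_re_le_of_sq_eq_one {S P : Matrix n n ℂ} (hS : S.IsHermitian) (hS1 : S * S = 1)
    (hP : P.PosSemidef) : (S * P).trace.re ≤ P.trace.re := by
  have h : ((1 - S)ᴴ * P * (1 - S)).PosSemidef := hP.conjTranspose_mul_mul_same _
  have h2 := trace_re_nonneg h
  -- `(1 - S)² = 2 (1 - S)`, so `1 - S` is positive semidefinite
  have h3 : (1 - S) * (1 - S) = (2 : ℂ) • (1 - S) := by
    rw [Matrix.sub_mul, Matrix.mul_sub, Matrix.mul_sub, hS1, two_smul]
    simp only [Matrix.one_mul, Matrix.mul_one]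
    abel
  rw [Matrix.trace_mul_comm, ← Matrix.mul_assoc, Matrix.conjTranspose_sub, hS.eq,
    Matrix.conjTranspose_one, h3, Matrix.smul_mul, Matrix.trace_smul, Matrix.sub_mul,
    Matrix.trace_sub, Matrix.one_mul] at h2
  simp at h2
  linarith

/-- Every decomposition into positive semidefinite parts bounds the trace norm; with
`exists_posSemidef_sub` this yields the triangle inequality. -/
theorem traceNorm_sub_le {P N : Matrix n n ℂ} (hP : P.PosSemidef) (hN : N.PosSemidef) :
    traceNorm (P - N) ≤ P.trace.re + N.trace.re := by
  obtain ⟨S, hS, hS1, h⟩ := exists_sign (hP.isHermitian.sub hN.isHermitian)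
  rw [h, Matrix.mul_sub, Matrix.trace_sub, Complex.sub_re]
  have h1 := trace_mul_re_le_of_sq_eq_one hS hS1 hP
  have h2 := trace_mul_re_le_of_sq_eq_one (S := -S) hS.neg (by simpa using hS1) hN
  simp only [Matrix.neg_mul, Matrix.trace_neg, Complex.neg_re] at h2
  linarith

theorem traceNorm_add_le {H K : Matrix n n ℂ} (hH : H.IsHermitian) (hK : K.IsHermitian) :
    traceNorm (H + K) ≤ traceNorm H + traceNorm K := by
  obtain ⟨P, N, hP, hN, rfl, h⟩ := exists_posSemidef_sub hH
  obtain ⟨P', N', hP', hN', rfl, h'⟩ := exists_posSemidef_sub hK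
  have := traceNorm_sub_le (hP.add hP') (hN.add hN')
  rw [show P - N + (P' - N') = P + P' - (N + N') by abel, h, h']
  simp only [Matrix.trace_add, Complex.add_re] at this
  linarith

theorem abs_trace_re_le_traceNorm {H : Matrix n n ℂ} (hH : H.IsHermitian) :
    |H.trace.re| ≤ traceNorm H := by
  obtain ⟨P, N, hP, hN, rfl, h⟩ := exists_posSemidef_sub hH
  rw [h, Matrix.trace_sub, Complex.sub_re, abs_le]
  constructor <;> linarith [trace_re_nonneg hP, trace_re_nonneg hN]

/-- The weighted comparison of the trace norm with the Hilbert–Schmidt norm: if `s` is an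
invertible Hermitian matrix with inverse `p`, then `‖M‖₁² ≤ tr (s⁴) tr ((p M p)²)`. -/
theorem traceNorm_sq_le_weighted {M s p : Matrix n n ℂ} (hM : M.IsHermitian)
    (hs : s.IsHermitian) (hp : p.IsHermitian) (hsp : s * p = 1) :
    traceNorm M ^ 2 ≤ (s * s * (s * s)).trace.re * (p * M * p * (p * M * p)).trace.re := by
  have hps : p * s = 1 := mul_eq_one_comm.mp hsp
  obtain ⟨S, hS, hS1, h⟩ := exists_sign hM
  set N := p * M * p with hN
  have hNH : N.IsHermitian := by
    have := Matrix.isHermitian_mul_mul_conjTranspose p hM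
    rwa [hp.eq] at this
  have hMN : M = s * N * s := by
    rw [hN]
    simp only [Matrix.mul_assoc]
    rw [hps, ← Matrix.mul_assoc s p, hsp, Matrix.mul_one, Matrix.one_mul]
  have hT : (S * M).trace = ((s * S * s)ᴴ * N).trace := by
    rw [Matrix.conjTranspose_mul, Matrix.conjTranspose_mul, hs.eq, hS.eq, hMN]
    simp only [Matrix.mul_assoc]
    rw [Matrix.trace_mul_comm s]
    simp only [Matrix.mul_assoc]
  have h1 := trace_re_sq_le (s * S * s) N
  rw [← hT, ← h, hNH.eq] at h1
  have h2 : ((s * S * s)ᴴ * (s * S * s)).trace = ((s * s * S)ᴴ * (S * (s * s))).trace := by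
    simp only [Matrix.conjTranspose_mul, hs.eq, hS.eq, Matrix.mul_assoc]
    rw [Matrix.trace_mul_comm s]
    simp only [Matrix.mul_assoc]
  have h3 := trace_re_sq_le (s * s * S) (S * (s * s))
  have h4 : ((s * s * S)ᴴ * (s * s * S)).trace = (s * s * (s * s)).trace := by
    simp only [Matrix.conjTranspose_mul, hs.eq, hS.eq, Matrix.mul_assoc]
    rw [Matrix.trace_mul_comm S]
    simp only [Matrix.mul_assoc, hS1, Matrix.mul_one]
  have h5 : ((S * (s * s))ᴴ * (S * (s * s))).trace = (s * s * (s * s)).trace := by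
    simp only [Matrix.conjTranspose_mul, hs.eq, hS.eq, Matrix.mul_assoc]
    rw [← Matrix.mul_assoc S S, hS1, Matrix.one_mul]
  rw [h4, h5, ← h2, ← sq] at h3
  have h6 : 0 ≤ (s * s * (s * s)).trace.re := by
    have := trace_conjTranspose_mul_self_re_nonneg (s * s)
    rwa [Matrix.conjTranspose_mul, hs.eq] at this
  have h7 := abs_le_of_sq_le_sq h3 h6
  have h8 : 0 ≤ (N * N).trace.re := by
    have := trace_conjTranspose_mul_self_re_nonneg N
    rwa [hNH.eq] at this
  exact h1.trans (mul_le_mul_of_nonneg_right (le_of_abs_le h7) h8)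

/-- A polar decomposition `M = C |M|`, with the partial isometry `C` completed by a projection `K`
onto the orthogonal complement of its initial space. -/
theorem exists_partialIsometry (M : Matrix n n ℂ) :
    ∃ C K : Matrix n n ℂ, Cᴴ * C + K * Kᴴ = 1 ∧ traceNorm M = (M * Cᴴ).trace.re := by
  set a := CFC.abs M with ha
  have ha0 : IsSelfAdjoint a := (CFC.abs_nonneg M).isSelfAdjoint
  have hcont : ∀ f : ℝ → ℝ, ContinuousOn f (spectrum ℝ a) :=
    fun f => (Matrix.finite_real_spectrum).continuousOn _
  -- since `0⁻¹ = 0`, `g` is the pseudo-inverse of `a` and `K` the projection onto `ker a`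
  set g := cfc (fun x : ℝ => x⁻¹) a with hg
  set K := cfc (fun x : ℝ => 1 - x⁻¹ * x) a with hK
  have hgH : gᴴ = g := cfc_predicate (R := ℝ) (fun x : ℝ => x⁻¹) a
  have hKH : Kᴴ = K := cfc_predicate (R := ℝ) (fun x : ℝ => 1 - x⁻¹ * x) a
  have haa : Mᴴ * M = a * a := (CFC.abs_mul_abs M).symm
  have hga : g * a = cfc (fun x : ℝ => x⁻¹ * x) a := by
    rw [cfc_mul (fun x : ℝ => x⁻¹) (fun x => x) a (hcont _) (hcont _), cfc_id' ℝ a ha0]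
  have hag : a * g = cfc (fun x : ℝ => x⁻¹ * x) a := by
    rw [← hga]
    conv_lhs => rw [← cfc_id' ℝ a ha0]
    conv_rhs => rw [← cfc_id' ℝ a ha0]
    exact cfc_commute_cfc _ _ a
  refine ⟨M * g, K, ?_, ?_⟩
  · rw [Matrix.conjTranspose_mul, hgH, hKH, Matrix.mul_assoc, ← Matrix.mul_assoc Mᴴ, haa,
      Matrix.mul_assoc a, ← Matrix.mul_assoc g, hga, hag, hK,
      ← cfc_mul _ _ a (hcont _) (hcont _), ← cfc_mul _ _ a (hcont _) (hcont _),
      ← cfc_add a _ _ (hcont _) (hcont _), ← cfc_one ℝ a]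
    refine cfc_congr fun x _ => ?_
    by_cases hx : x = 0
    · simp [hx]
    · simp [hx]
  · rw [traceNorm_eq_trace_abs, ← ha, Matrix.conjTranspose_mul, hgH, Matrix.trace_mul_comm,
      Matrix.mul_assoc, haa, ← Matrix.mul_assoc, hga]
    congr 2
    have h : cfc (fun x : ℝ => x⁻¹ * x) a * a = cfc (fun x : ℝ => x⁻¹ * x * x) a := by
      rw [cfc_mul (fun x : ℝ => x⁻¹ * x) (fun x => x) a (hcont _) (hcont _), cfc_id' ℝ a ha0]
    rw [h]
    conv_lhs => rw [← cfc_id' ℝ a ha0]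
    refine cfc_congr fun x _ => ?_
    by_cases hx : x = 0
    · simp [hx]
    · simp [hx]

/-- The trace distance of `X X†` and `Y Y†` in terms of the overlap of `X` and `Y`, from
`2 (X X† - Y Y†) = (X - Y)(X + Y)† + (X + Y)(X - Y)†` and the Cauchy–Schwarz inequality. -/
theorem traceNorm_mul_conjTranspose_sub_le (X Y : Matrix n m ℂ) :
    traceNorm (X * Xᴴ - Y * Yᴴ) ^ 2 ≤
      ((Xᴴ * X).trace.re + (Yᴴ * Y).trace.re) ^ 2 - 4 * (Xᴴ * Y).trace.re ^ 2 := by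
  have hXY : (X * Xᴴ - Y * Yᴴ).IsHermitian :=
    (Matrix.isHermitian_mul_conjTranspose_self X).sub (Matrix.isHermitian_mul_conjTranspose_self Y)
  obtain ⟨S, hS, hS1, h⟩ := exists_sign hXY
  have hc : (Yᴴ * X).trace.re = (Xᴴ * Y).trace.re := by
    have : Yᴴ * X = (Xᴴ * Y)ᴴ := by simp
    rw [this, Matrix.trace_conjTranspose]; simp
  have hc' : ∀ P Q : Matrix n m ℂ, (Pᴴ * S * Q).trace.re = (Qᴴ * S * P).trace.re := by
    intro P Q
    have : Qᴴ * S * P = (Pᴴ * S * Q)ᴴ := by simp [hS.eq, Matrix.mul_assoc]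
    rw [this, Matrix.trace_conjTranspose]; simp
  have h1 : (S * (X * Xᴴ - Y * Yᴴ)).trace.re = ((X - Y)ᴴ * (S * (X + Y))).trace.re := by
    have e1 : ∀ P : Matrix n m ℂ, (S * (P * Pᴴ)).trace = (Pᴴ * S * P).trace := by
      intro P
      rw [← Matrix.mul_assoc, Matrix.trace_mul_comm, Matrix.mul_assoc]
    have e2 := hc' X Y
    rw [Matrix.mul_sub, Matrix.trace_sub, e1, e1]
    simp only [Matrix.conjTranspose_sub, Matrix.sub_mul, Matrix.mul_add,
      Matrix.trace_sub, Matrix.trace_add, Complex.sub_re, Complex.add_re,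
      ← Matrix.mul_assoc]
    linarith
  have h2 := trace_re_sq_le (X - Y) (S * (X + Y))
  rw [← h1, ← h] at h2
  have h3 : (S * (X + Y))ᴴ * (S * (X + Y)) = (X + Y)ᴴ * (X + Y) := by
    rw [Matrix.conjTranspose_mul, hS.eq, Matrix.mul_assoc, ← Matrix.mul_assoc S, hS1,
      Matrix.one_mul]
  rw [h3] at h2
  simp only [Matrix.conjTranspose_sub, Matrix.conjTranspose_add, Matrix.sub_mul, Matrix.mul_add,
    Matrix.mul_sub, Matrix.add_mul,
      Matrix.trace_sub, Matrix.trace_add, Complex.sub_re, Complex.add_re, hc] at h2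
  nlinarith

/-- The Fuchs–van de Graaf inequality for subnormalised states. -/
theorem traceNorm_sub_le_two_mul_fidelityDist {ρ σ : Matrix n n ℂ} (hρ : ρ.PosSemidef)
    (hσ : σ.PosSemidef) (hρ1 : ρ.trace.re ≤ 1) (hσ1 : σ.trace.re ≤ 1) :
    traceNorm (ρ - σ) ≤ 2 * fidelityDist ρ σ := by
  set a := CFC.sqrt ρ with ha
  set b := CFC.sqrt σ with hb
  have haH : aᴴ = a := (CFC.sqrt_nonneg ρ).isSelfAdjoint
  have hbH : bᴴ = b := (CFC.sqrt_nonneg σ).isSelfAdjoint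
  have haa : a * a = ρ := CFC.sqrt_mul_sqrt_self ρ hρ.nonneg
  have hbb : b * b = σ := CFC.sqrt_mul_sqrt_self σ hσ.nonneg
  obtain ⟨C, K, hCK, hF⟩ := exists_partialIsometry (a * b)
  -- the extra columns make `Y Y† = σ` exact although `C` is only a partial isometry
  let X : Matrix n (n ⊕ n) ℂ := Matrix.fromCols a 0
  let Y : Matrix n (n ⊕ n) ℂ := Matrix.fromCols (b * Cᴴ) (b * K)
  have hX : X * Xᴴ = ρ := by
    simp [X, Matrix.conjTranspose_fromCols_eq_fromRows_conjTranspose,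
      Matrix.fromCols_mul_fromRows, haH, haa]
  have hY : Y * Yᴴ = σ := by
    have : b * Cᴴ * (C * b) + b * K * (Kᴴ * b) = b * (Cᴴ * C + K * Kᴴ) * b := by
      noncomm_ring
    simp only [Y, Matrix.conjTranspose_fromCols_eq_fromRows_conjTranspose,
      Matrix.fromCols_mul_fromRows, Matrix.conjTranspose_mul, Matrix.conjTranspose_conjTranspose,
      hbH]
    rw [this, hCK, Matrix.mul_one, hbb]
  have hXY : (Xᴴ * Y).trace.re = fidelity ρ σ := by
    rw [fidelity, ← ha, ← hb, hF, Matrix.trace_mul_comm]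
    simp only [X, Y, Matrix.conjTranspose_fromCols_eq_fromRows_conjTranspose,
      Matrix.fromCols_mul_fromRows, haH]
    simp [Matrix.mul_assoc, Matrix.trace_mul_comm a]
  have h := traceNorm_mul_conjTranspose_sub_le X Y
  rw [Matrix.trace_mul_comm Xᴴ X, Matrix.trace_mul_comm Yᴴ Y, hX, hY, hXY] at h
  have h0 := trace_re_nonneg hρ
  have h0' := trace_re_nonneg hσ
  have h4 : (ρ.trace.re + σ.trace.re) ^ 2 ≤ 2 ^ 2 :=
    pow_le_pow_left₀ (by linarith) (by linarith) 2
  have h5 : (traceNorm (ρ - σ) / 2) ^ 2 ≤ 1 - fidelity ρ σ ^ 2 := by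
    rw [div_pow]; linarith
  have := Real.le_sqrt_of_sq_le h5
  rw [fidelityDist]
  linarith

theorem fidelityDist_self_of_trace_eq_one {ρ : Matrix n n ℂ} (hρ : ρ.PosSemidef)
    (h1 : ρ.trace = 1) : fidelityDist ρ ρ = 0 := by
  have : fidelity ρ ρ = 1 := by
    rw [fidelity, CFC.sqrt_mul_sqrt_self ρ hρ.nonneg, traceNorm_eq_trace_abs,
      CFC.abs_of_nonneg ρ hρ.nonneg, h1, Complex.one_re]
  simp [fidelityDist, this]

end TraceNorm

/-! ### Bilinear forms invariant under unitary conjugation -/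

section InvariantForms
variable {A : Type*} [Fintype A] [DecidableEq A]

theorem eq_sum_smul_single (X : Matrix A A ℂ) :
    X = ∑ a, ∑ b, X a b • Matrix.single a b (1 : ℂ) := by
  conv_lhs => rw [Matrix.matrix_eq_sum_single X]
  simp [Matrix.smul_single]

theorem single_one_mul_single_one (a b c d : A) :
    Matrix.single a b (1 : ℂ) * Matrix.single c d 1 = if b = c then Matrix.single a d 1 else 0 := by
  by_cases h : b = c
  · subst h; simp
  · simp [h]

/-- A linear map on matrices that commutes with all inner derivations `X ↦ H X - X H` is a
combination of the identity and of `X ↦ tr X • 1`. -/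
theorem exists_eq_trace_smul_add_smul [Nontrivial A] (L : Matrix A A ℂ →ₗ[ℂ] Matrix A A ℂ)
    (hL : ∀ H X, L (H * X - X * H) = H * L X - L X * H) :
    ∃ α β : ℂ, ∀ X, L X = (α * X.trace) • (1 : Matrix A A ℂ) + β • X := by
  obtain ⟨i, j, hij⟩ := exists_pair_ne A
  let e : A → A → Matrix A A ℂ := fun a b => Matrix.single a b 1
  have he : ∀ a b c d, e a b * e c d = if b = c then e a d else 0 := single_one_mul_single_one
  set β := L (e i j) i j with hβ
  set K : Matrix A A ℂ →ₗ[ℂ] Matrix A A ℂ := L - β • LinearMap.id with hK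
  have hKL : ∀ H X, K (H * X - X * H) = H * K X - K X * H := by
    intro H X
    simp only [hK, LinearMap.sub_apply, hL, LinearMap.smul_apply, LinearMap.id_apply,
      Matrix.mul_sub, Matrix.sub_mul, smul_sub, Matrix.mul_smul, Matrix.smul_mul]
    abel
  have hid : ∀ H X, K X = 0 → K (H * X - X * H) = 0 := by
    intro H X h; rw [hKL, h]; simp
  have hid' : ∀ H X, K X = 0 → K (X * H - H * X) = 0 := by
    intro H X h; rw [← neg_sub, map_neg, hid H X h, neg_zero]
  -- commuting with the diagonal units forces `L (e i j)` to be a multiple of `e i j`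
  have h0 : K (e i j) = 0 := by
    have key : ∀ k a b, ((if k = i then (1 : ℂ) else 0) - (if k = j then 1 else 0)) *
        L (e i j) a b = ((if a = k then 1 else 0) - (if b = k then 1 else 0)) * L (e i j) a b := by
      intro k a b
      have h := congrFun (congrFun (hL (e k k) (e i j)) a) b
      have h1 : e k k * e i j - e i j * e k k
          = ((if k = i then (1 : ℂ) else 0) - (if k = j then 1 else 0)) • e i j := by
        rw [he, he, sub_smul]
        congr 1
        · split_ifs with h
          · simp [h]
          · simp
        · by_cases h : k = j
          · simp [h]
          · simp [h, Ne.symm h]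
      rw [h1, map_smul] at h
      simp only [Matrix.smul_apply, smul_eq_mul, Matrix.sub_apply] at h
      rw [h, sub_mul]
      congr 1
      · by_cases h : a = k
        · subst h; simp [e]
        · simp [e, h]
      · by_cases h : b = k
        · subst h; simp [e]
        · simp [e, h]
    ext a b
    have hi := key i a b
    have hj := key j a b
    simp only [hK, LinearMap.sub_apply, LinearMap.smul_apply, LinearMap.id_apply,
      Matrix.sub_apply, Matrix.smul_apply, Matrix.zero_apply, smul_eq_mul, e, Matrix.single_apply]
    simp only [if_true, hij, hij.symm, if_false, sub_zero, zero_sub, one_mul, neg_mul] at hi hj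
    by_cases hai : a = i
    · by_cases hbj : b = j
      · subst hai hbj; simp [hβ, e]
      · subst hai
        simp only [hbj, if_false, hij, sub_zero, zero_mul, neg_eq_zero] at hj
        rw [hj]; simp [Ne.symm hbj]
    · have : L (e i j) a b = 0 := by
        by_cases hbi : b = i
        · simp only [hai, hbi, if_false, if_true, zero_sub, neg_mul, one_mul] at hi
          rw [hbi]
          linear_combination (1 / 2) * hi
        · simpa [hai, hbi] using hi
      rw [this]; simp [Ne.symm hai]
  -- the kernel of `K` is a Lie ideal, so it contains all units off the diagonal
  have hD : K (e i i - e j j) = 0 := by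
    have := hid' (e j i) (e i j) h0
    rwa [he, he, if_pos rfl, if_pos rfl] at this
  have hcol : ∀ k, k ≠ i → K (e k i) = 0 := by
    intro k hk
    have h := hid (e k i) _ hD
    rw [Matrix.mul_sub, Matrix.sub_mul, he, he, he, he, if_pos rfl, if_neg hij,
      if_neg (Ne.symm hk)] at h
    by_cases hkj : j = k
    · subst hkj
      rw [if_pos rfl, show e j i - 0 - (0 - e j i) = (2 : ℂ) • e j i by rw [two_smul]; abel,
        map_smul] at h
      exact (smul_eq_zero.mp h).resolve_left two_ne_zero
    · rwa [if_neg hkj, sub_zero, sub_zero, sub_zero] at h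
  have hrow : ∀ l, l ≠ i → K (e i l) = 0 := by
    intro l hl
    have h := hid' (e i l) _ hD
    rw [Matrix.mul_sub, Matrix.sub_mul, he, he, he, he, if_pos rfl, if_neg hij.symm,
      if_neg hl] at h
    by_cases hkj : l = j
    · subst hkj
      rw [if_pos rfl, show e i l - 0 - (0 - e i l) = (2 : ℂ) • e i l by rw [two_smul]; abel,
        map_smul] at h
      exact (smul_eq_zero.mp h).resolve_left two_ne_zero
    · rwa [if_neg hkj, sub_zero, sub_zero, sub_zero] at h
  have hoff : ∀ k l, k ≠ l → K (e k l) = 0 := by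
    intro k l hkl
    by_cases hk : k = i
    · subst hk; exact hrow l hkl.symm
    · by_cases hl : l = i
      · subst hl; exact hcol k hk
      · have h := hid' (e i l) _ (hcol k hk)
        rwa [he, he, if_pos rfl, if_neg hkl.symm, sub_zero] at h
  have hdiag : ∀ k, K (e k k) = K (e i i) := by
    intro k
    by_cases hk : k = i
    · rw [hk]
    · have h := hid' (e i k) _ (hcol k hk)
      rw [he, he, if_pos rfl, if_pos rfl, map_sub, sub_eq_zero] at h
      exact h
  obtain ⟨α, hα⟩ : K (e i i) ∈ Set.range (Matrix.scalar A) := by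
    refine Matrix.mem_range_scalar_of_commute_single fun k l hkl => ?_
    have h := hKL (e k l) (e l l)
    rw [he, he, if_pos rfl, if_neg hkl.symm, sub_zero, hoff k l hkl, hdiag] at h
    exact (sub_eq_zero.mp h.symm)
  have hK' : ∀ X, K X = (α * X.trace) • (1 : Matrix A A ℂ) := by
    intro X
    have hX : X = ∑ a, ∑ b, X a b • e a b := eq_sum_smul_single X
    have h1 : ∀ a b, K (e a b) = if a = b then α • (1 : Matrix A A ℂ) else 0 := by
      intro a b
      split_ifs with h
      · subst h
        rw [hdiag, ← hα]
        ext x y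
        simp [Matrix.diagonal_apply, Matrix.one_apply]
      · exact hoff a b h
    conv_lhs => rw [hX]
    simp only [map_sum, map_smul, h1]
    simp [Matrix.trace, smul_smul, Finset.sum_smul, Finset.mul_sum, mul_comm]
  refine ⟨α, β, fun X => ?_⟩
  rw [← hK' X]
  simp [hK]

/-- A bilinear form invariant under unitary conjugation is invariant under the derivation given by
a Hermitian involution `H`: the unitaries `(1 ± i H) / √2` conjugate `X` to matrices that differ
by `i (H X - X H)`. -/
theorem derivation_of_involution (b : Matrix A A ℂ →ₗ[ℂ] Matrix A A ℂ →ₗ[ℂ] ℂ)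
    (hb : ∀ U ∈ Matrix.unitaryGroup A ℂ, ∀ X Y, b (U * X * Uᴴ) (U * Y * Uᴴ) = b X Y)
    {H : Matrix A A ℂ} (hH : H.IsHermitian) (h1 : H * H = 1) (X Y : Matrix A A ℂ) :
    b (H * X - X * H) Y + b X (H * Y - Y * H) = 0 := by
  let r : ℂ := ((Real.sqrt 2)⁻¹ : ℝ)
  have hr : r * r = 1 / 2 := by
    simp only [r, ← Complex.ofReal_mul, ← mul_inv, Real.mul_self_sqrt zero_le_two]
    norm_num
  have hrs : star r = r := Complex.conj_ofReal _
  have hI : Complex.I * Complex.I = -1 := Complex.I_mul_I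
  let U : Matrix A A ℂ := r • (1 + Complex.I • H)
  have hUs : Uᴴ = r • (1 - Complex.I • H) := by
    simp [U, Matrix.conjTranspose_smul, hrs, hH.eq, sub_eq_add_neg]
  have hU : U ∈ Matrix.unitaryGroup A ℂ := by
    rw [Matrix.mem_unitaryGroup_iff, Matrix.star_eq_conjTranspose, hUs]
    have h2 : (1 + Complex.I • H) * (1 - Complex.I • H) = (2 : ℂ) • 1 := by
      simp only [Matrix.smul_mul, Matrix.mul_smul, Matrix.add_mul, Matrix.mul_sub,
        Matrix.one_mul, Matrix.mul_one, h1]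
      match_scalars <;> first | ring1 | linear_combination -hI
    rw [Matrix.smul_mul, Matrix.mul_smul, smul_smul, hr, h2, smul_smul]
    norm_num
  have hUU' : U * Uᴴ = 1 := Matrix.mem_unitaryGroup_iff.mp hU
  have hdiff : ∀ Z, U * Z * Uᴴ - Uᴴ * Z * U = Complex.I • (H * Z - Z * H) := by
    intro Z
    rw [hUs]
    simp only [U, Matrix.smul_mul, Matrix.mul_smul]
    rw [smul_smul, smul_smul, hr, ← smul_sub]
    simp only [Matrix.smul_mul, Matrix.mul_smul, Matrix.add_mul, Matrix.mul_sub,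
      Matrix.mul_add, Matrix.sub_mul, Matrix.one_mul, Matrix.mul_one]
    module
  have e1 : b (U * X * Uᴴ) Y = b X (Uᴴ * Y * U) := by
    rw [← hb U hU X]
    congr 1
    simp only [← Matrix.mul_assoc, hUU', Matrix.one_mul]
    rw [Matrix.mul_assoc, hUU', Matrix.mul_one]
  have e2 : b (Uᴴ * X * U) Y = b X (U * Y * Uᴴ) := by
    rw [← hb U hU (Uᴴ * X * U)]
    congr 2
    simp only [← Matrix.mul_assoc, hUU', Matrix.one_mul]
    rw [Matrix.mul_assoc, hUU', Matrix.mul_one]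
  have e3 : b (Complex.I • (H * X - X * H)) Y = -b X (Complex.I • (H * Y - Y * H)) := by
    rw [← hdiff, ← hdiff, map_sub, map_sub, LinearMap.sub_apply, e1, e2]
    ring
  simp only [map_smul, LinearMap.smul_apply, smul_eq_mul] at e3
  have e4 : Complex.I * (b (H * X - X * H) Y + b X (H * Y - Y * H)) = 0 := by
    rw [mul_add, e3]; ring
  exact (mul_eq_zero.mp e4).resolve_left Complex.I_ne_zero

/-- Hermitian involutions span all matrices, so invariance under conjugation implies invariance
under every inner derivation. -/
theorem derivation_of_invariant (b : Matrix A A ℂ →ₗ[ℂ] Matrix A A ℂ →ₗ[ℂ] ℂ)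
    (hb : ∀ U ∈ Matrix.unitaryGroup A ℂ, ∀ X Y, b (U * X * Uᴴ) (U * Y * Uᴴ) = b X Y)
    (H X Y : Matrix A A ℂ) :
    b (H * X - X * H) Y + b X (H * Y - Y * H) = 0 := by
  let S : Submodule ℂ (Matrix A A ℂ) :=
    { carrier := {H | ∀ X Y, b (H * X - X * H) Y + b X (H * Y - Y * H) = 0}
      zero_mem' := by intro X Y; simp
      add_mem' := by
        intro H K hH hK X Y
        have h1 := hH X Y
        have h2 := hK X Y
        simp only [Matrix.add_mul, Matrix.mul_add, map_sub, map_add, LinearMap.sub_apply,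
          LinearMap.add_apply] at h1 h2 ⊢
        linear_combination h1 + h2
      smul_mem' := by
        intro c H hH X Y
        have h1 := hH X Y
        simp only [Matrix.smul_mul, Matrix.mul_smul, map_sub, map_smul, LinearMap.sub_apply,
          LinearMap.smul_apply, smul_eq_mul] at h1 ⊢
        linear_combination c * h1 }
  have hS : ∀ H : Matrix A A ℂ, H.IsHermitian → H * H = 1 → H ∈ S :=
    fun H h h1 X Y => derivation_of_involution b hb h h1 X Y
  have h1 : (1 : Matrix A A ℂ) ∈ S := hS 1 Matrix.isHermitian_one (by simp)
  let e : A → A → Matrix A A ℂ := fun a b => Matrix.single a b 1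
  have hm : ∀ a b c d, e a b * e c d = if b = c then e a d else 0 := single_one_mul_single_one
  have hd : ∀ i, e i i ∈ S := by
    intro i
    have h2 : 1 - (2 : ℂ) • e i i ∈ S := by
      refine hS _ ?_ ?_
      · simp [Matrix.IsHermitian, e]
      · simp only [Matrix.sub_mul, Matrix.mul_sub, Matrix.smul_mul, Matrix.mul_smul,
          Matrix.one_mul, Matrix.mul_one, hm, if_true]
        module
    have h3 : e i i = (1 / 2 : ℂ) • (1 - (1 - (2 : ℂ) • e i i)) := by module
    rw [h3]
    exact S.smul_mem _ (S.sub_mem h1 h2)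
  have ho : ∀ i j, i ≠ j → ∀ z : ℂ, z * star z = 1 → z • e i j + star z • e j i ∈ S := by
    intro i j hij z hz
    have h2 : 1 - e i i - e j j - (z • e i j + star z • e j i) ∈ S := by
      refine hS _ ?_ ?_
      · simp only [Matrix.IsHermitian, e, Matrix.conjTranspose_sub, Matrix.conjTranspose_add,
          Matrix.conjTranspose_one, Matrix.conjTranspose_smul, Matrix.conjTranspose_single,
          star_one, star_star]
        abel
      · simp only [Matrix.sub_mul, Matrix.mul_sub, Matrix.smul_mul, Matrix.mul_smul,
          Matrix.add_mul, Matrix.mul_add, smul_zero,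
          Matrix.one_mul, Matrix.mul_one, hm, if_true, if_neg hij, if_neg hij.symm]
        match_scalars <;> first | ring1 | linear_combination hz
    have h3 : z • e i j + star z • e j i =
        1 - e i i - e j j - (1 - e i i - e j j - (z • e i j + star z • e j i)) := by abel
    rw [h3]
    exact S.sub_mem (S.sub_mem (S.sub_mem h1 (hd i)) (hd j)) h2
  have he : ∀ i j, e i j ∈ S := by
    intro i j
    by_cases hij : i = j
    · subst hij; exact hd i
    · have h2 := ho i j hij 1 (by simp)
      have h3 := ho i j hij Complex.I (by simp)
      have h4 : e i j = (1 / 2 : ℂ) • (((1 : ℂ) • e i j + star (1 : ℂ) • e j i)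
          - Complex.I • (Complex.I • e i j + star Complex.I • e j i)) := by
        simp only [smul_add, smul_sub, smul_smul, Complex.star_def, Complex.conj_I, map_one,
          mul_neg, Complex.I_mul_I]
        module
      rw [h4]
      exact S.smul_mem _ (S.sub_mem h2 (S.smul_mem _ h3))
  have hH : H ∈ S := by
    have hX : H = ∑ a, ∑ b, H a b • e a b := eq_sum_smul_single H
    rw [hX]
    exact S.sum_mem fun a _ => S.sum_mem fun b _ => S.smul_mem _ (he a b)
  exact hH X Y

/-- The commutant theorem for `U ⊗ U`, for bilinear forms: a form invariant under unitary
conjugation is a combination of `tr X tr Y` and `tr (X Y)`. If it is moreover nonnegative on the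
pairs `(eᵢᵢ, eₖₖ)` and `(eᵢₖ, eₖᵢ)`, the coefficients may be taken nonnegative. -/
theorem exists_eq_trace_mul_trace_add_trace_mul [Nonempty A]
    (b : Matrix A A ℂ →ₗ[ℂ] Matrix A A ℂ →ₗ[ℂ] ℂ)
    (hb : ∀ U ∈ Matrix.unitaryGroup A ℂ, ∀ X Y, b (U * X * Uᴴ) (U * Y * Uᴴ) = b X Y) :
    ∃ α β : ℂ, (∀ X Y, b X Y = α * (X.trace * Y.trace) + β * (X * Y).trace) ∧
      ((∀ i k, 0 ≤ b (Matrix.single i i 1) (Matrix.single k k 1)) →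
        (∀ i k, 0 ≤ b (Matrix.single i k 1) (Matrix.single k i 1)) → 0 ≤ α ∧ 0 ≤ β) := by
  let e : A → A → Matrix A A ℂ := fun a b => Matrix.single a b 1
  cases subsingleton_or_nontrivial A with
  | inl hs =>
    obtain ⟨i⟩ := ‹Nonempty A›
    refine ⟨b (e i i) (e i i), 0, fun X Y => ?_, fun h _ => ⟨h i i, le_rfl⟩⟩
    have hu : Unique A := ⟨⟨i⟩, fun a => Subsingleton.elim a i⟩
    have hX' : ∀ X : Matrix A A ℂ, X = X.trace • e i i := by
      intro X
      ext a c
      rw [Subsingleton.elim a i, Subsingleton.elim c i]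
      have : X.trace = X i i := by
        rw [Matrix.trace, Fintype.sum_subsingleton _ i]; rfl
      simp [e, this]
    conv_lhs => rw [hX' X, hX' Y]
    simp only [map_smul, LinearMap.smul_apply, smul_eq_mul]
    ring
  | inr hn =>
    have hder := derivation_of_invariant b hb
    let L : Matrix A A ℂ →ₗ[ℂ] Matrix A A ℂ :=
      { toFun := fun X => Matrix.of fun a c => b X (e c a)
        map_add' := by intro X Y; ext a c; simp
        map_smul' := by intro r X; ext a c; simp }
    have hLb : ∀ X Y, b X Y = (L X * Y).trace := by
      intro X Y
      conv_lhs => rw [eq_sum_smul_single Y]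
      simp only [map_sum, map_smul, smul_eq_mul, Matrix.trace, Matrix.diag_apply, Matrix.mul_apply]
      rw [Finset.sum_comm]
      exact Finset.sum_congr rfl fun a _ => Finset.sum_congr rfl fun c _ => mul_comm _ _
    have htr : ∀ M N : Matrix A A ℂ, (∀ Y, (M * Y).trace = (N * Y).trace) → M = N := by
      intro M N h
      exact Matrix.ext_iff_trace_mul_right.mpr h
    obtain ⟨α, β, hαβ⟩ := exists_eq_trace_smul_add_smul L (by
      intro H X
      refine htr _ _ fun Y => ?_
      rw [← hLb, eq_neg_of_add_eq_zero_left (hder H X Y), hLb, Matrix.mul_sub, Matrix.trace_sub,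
        Matrix.sub_mul, Matrix.trace_sub, Matrix.mul_assoc H, Matrix.trace_mul_comm H,
        ← Matrix.mul_assoc, ← Matrix.mul_assoc]
      ring)
    have hform : ∀ X Y, b X Y = α * (X.trace * Y.trace) + β * (X * Y).trace := by
      intro X Y
      rw [hLb, hαβ, Matrix.add_mul, Matrix.trace_add, Matrix.smul_mul, Matrix.smul_mul,
        Matrix.trace_smul, Matrix.trace_smul, Matrix.one_mul]
      simp only [smul_eq_mul]
      ring
    refine ⟨α, β, hform, fun h1 h2 => ?_⟩
    obtain ⟨i, k, hik⟩ := exists_pair_ne A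
    have h1' := h1 i k
    have h2' := h2 i k
    rw [hform] at h1' h2'
    constructor
    · simpa [hik] using h1'
    · simpa [Matrix.trace_single_eq_of_ne, hik] using h2'

end InvariantForms

/-! ### Moments of the Haar measure -/

section HaarAverages
variable {A : Type*} [Fintype A] [DecidableEq A]

instance instIsHaarMeasureUnitaryHaar : (unitaryHaar A).IsHaarMeasure := by
  unfold unitaryHaar; infer_instance

instance instIsProbabilityMeasureUnitaryHaar : IsProbabilityMeasure (unitaryHaar A) :=
  ⟨by
    have := Measure.haarMeasure_self (G := Matrix.unitaryGroup A ℂ) (K₀ := ⊤)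
    simpa [unitaryHaar] using this⟩

instance instIsMulRightInvariantUnitaryHaar : (unitaryHaar A).IsMulRightInvariant := by
  constructor
  intro g
  -- a right translate is again a Haar probability measure, and that is unique
  have : IsProbabilityMeasure (Measure.map (· * g) (unitaryHaar A)) :=
    Measure.isProbabilityMeasure_map (by fun_prop)
  exact Measure.isHaarMeasure_eq_of_isProbabilityMeasure _ _

theorem integrable_of_continuous {f : Matrix.unitaryGroup A ℂ → ℂ} (hf : Continuous f) :
    Integrable f (unitaryHaar A) :=
  hf.integrable_of_hasCompactSupport (HasCompactSupport.of_compactSpace f)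

theorem bilin_apply_eq_sum (b : Matrix A A ℂ →ₗ[ℂ] Matrix A A ℂ →ₗ[ℂ] ℂ) (X Y : Matrix A A ℂ) :
    b X Y = ∑ i, ∑ j, ∑ k, ∑ l, X i j * Y k l *
      b (Matrix.single i j 1) (Matrix.single k l 1) := by
  conv_lhs => rw [eq_sum_smul_single X]
  simp only [map_sum, LinearMap.sum_apply, map_smul, LinearMap.smul_apply, smul_eq_mul]
  refine Finset.sum_congr rfl fun i _ => Finset.sum_congr rfl fun j _ => ?_
  conv_lhs => rw [eq_sum_smul_single Y]
  simp only [map_sum, map_smul, smul_eq_mul, Finset.mul_sum, mul_assoc]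

theorem continuous_bilin_conj (b : Matrix A A ℂ →ₗ[ℂ] Matrix A A ℂ →ₗ[ℂ] ℂ)
    (X Y : Matrix A A ℂ) : Continuous fun U : Matrix.unitaryGroup A ℂ =>
      b ((U : Matrix A A ℂ) * X * (U : Matrix A A ℂ)ᴴ)
        ((U : Matrix A A ℂ) * Y * (U : Matrix A A ℂ)ᴴ) := by
  have hc : ∀ (X : Matrix A A ℂ) i j, Continuous fun U : Matrix.unitaryGroup A ℂ =>
      ((U : Matrix A A ℂ) * X * (U : Matrix A A ℂ)ᴴ) i j := by
    intro X i j
    have : Continuous fun U : Matrix.unitaryGroup A ℂ =>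
      ((U : Matrix A A ℂ) * X * (U : Matrix A A ℂ)ᴴ) := by fun_prop
    exact this.matrix_elem i j
  rw [funext fun U : Matrix.unitaryGroup A ℂ => bilin_apply_eq_sum b
    ((U : Matrix A A ℂ) * X * (U : Matrix A A ℂ)ᴴ) ((U : Matrix A A ℂ) * Y * (U : Matrix A A ℂ)ᴴ)]
  have := hc X
  have := hc Y
  fun_prop

theorem integrable_bilin_conj (b : Matrix A A ℂ →ₗ[ℂ] Matrix A A ℂ →ₗ[ℂ] ℂ)
    (X Y : Matrix A A ℂ) : Integrable (fun U : Matrix.unitaryGroup A ℂ =>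
      b ((U : Matrix A A ℂ) * X * (U : Matrix A A ℂ)ᴴ)
        ((U : Matrix A A ℂ) * Y * (U : Matrix A A ℂ)ᴴ)) (unitaryHaar A) :=
  integrable_of_continuous (continuous_bilin_conj b X Y)

/-- The average of a bilinear form over simultaneous unitary conjugation of its arguments. -/
noncomputable def twirl (b : Matrix A A ℂ →ₗ[ℂ] Matrix A A ℂ →ₗ[ℂ] ℂ) :
    Matrix A A ℂ →ₗ[ℂ] Matrix A A ℂ →ₗ[ℂ] ℂ :=
  LinearMap.mk₂ ℂ
    (fun X Y => ∫ U : Matrix.unitaryGroup A ℂ, b ((U : Matrix A A ℂ) * X * (U : Matrix A A ℂ)ᴴ)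
        ((U : Matrix A A ℂ) * Y * (U : Matrix A A ℂ)ᴴ) ∂(unitaryHaar A))
    (fun X X' Y => by
      rw [← integral_add (integrable_bilin_conj b _ _) (integrable_bilin_conj b _ _)]
      simp only [Matrix.mul_add, Matrix.add_mul, map_add, LinearMap.add_apply])
    (fun c X Y => by
      rw [← integral_smul]
      simp only [Matrix.mul_smul, Matrix.smul_mul, map_smul, LinearMap.smul_apply])
    (fun X Y Y' => by
      rw [← integral_add (integrable_bilin_conj b _ _) (integrable_bilin_conj b _ _)]
      simp only [Matrix.mul_add, Matrix.add_mul, map_add])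
    (fun c X Y => by
      rw [← integral_smul]
      simp only [Matrix.mul_smul, Matrix.smul_mul, map_smul])

theorem twirl_apply (b : Matrix A A ℂ →ₗ[ℂ] Matrix A A ℂ →ₗ[ℂ] ℂ) (X Y : Matrix A A ℂ) :
    twirl b X Y = ∫ U : Matrix.unitaryGroup A ℂ,
      b ((U : Matrix A A ℂ) * X * (U : Matrix A A ℂ)ᴴ)
        ((U : Matrix A A ℂ) * Y * (U : Matrix A A ℂ)ᴴ) ∂(unitaryHaar A) := rfl

theorem twirl_conj (b : Matrix A A ℂ →ₗ[ℂ] Matrix A A ℂ →ₗ[ℂ] ℂ) {V : Matrix A A ℂ}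
    (hV : V ∈ Matrix.unitaryGroup A ℂ) (X Y : Matrix A A ℂ) :
    twirl b (V * X * Vᴴ) (V * Y * Vᴴ) = twirl b X Y := by
  rw [twirl_apply, twirl_apply]
  rw [← integral_mul_right_eq_self (μ := unitaryHaar A) (fun U : Matrix.unitaryGroup A ℂ =>
      b ((U : Matrix A A ℂ) * X * (U : Matrix A A ℂ)ᴴ)
        ((U : Matrix A A ℂ) * Y * (U : Matrix A A ℂ)ᴴ)) ⟨V, hV⟩]
  simp only [Submonoid.coe_mul, Matrix.conjTranspose_mul, Matrix.mul_assoc]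

/-- The Casimir tensor `∑ eᵢⱼ ⊗ eⱼᵢ` is invariant under unitary conjugation. -/
theorem sum_bilin_single_conj (b : Matrix A A ℂ →ₗ[ℂ] Matrix A A ℂ →ₗ[ℂ] ℂ) {U : Matrix A A ℂ}
    (hU : U ∈ Matrix.unitaryGroup A ℂ) :
    ∑ i, ∑ j, b (U * Matrix.single i j 1 * Uᴴ) (U * Matrix.single j i 1 * Uᴴ) =
      ∑ i, ∑ j, b (Matrix.single i j 1) (Matrix.single j i 1) := by
  have hUU : U * Uᴴ = 1 := Matrix.mem_unitaryGroup_iff.mp hU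
  have h1 : ∀ a c, ∑ i, U a i * star (U c i) = if a = c then 1 else 0 := by
    intro a c
    have := congrFun (congrFun hUU a) c
    simpa [Matrix.mul_apply, Matrix.one_apply] using this
  let W : A → A → Matrix A A ℂ := fun i j => U * Matrix.single i j 1 * Uᴴ
  have hentry : ∀ i j a c, W i j a c = U a i * star (U c j) := by
    intro i j a c
    simp [W, Matrix.mul_apply, Matrix.single_apply, ite_and]
  have h2 : ∀ k l m n, ∑ i, ∑ j, W i j k l * W j i m n =
      (if k = n then 1 else 0) * (if m = l then 1 else 0) := by
    intro k l m n
    simp only [hentry]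
    rw [← h1, ← h1, Finset.sum_mul_sum]
    exact Finset.sum_congr rfl fun i _ => Finset.sum_congr rfl fun j _ => by ring
  have h3 : ∀ f : A → A → A → ℂ, ∑ i, ∑ j, ∑ k, f i j k = ∑ k, ∑ i, ∑ j, f i j k := by
    intro f
    rw [Finset.sum_comm, Finset.sum_congr rfl fun j _ => Finset.sum_comm, Finset.sum_comm]
    exact Finset.sum_congr rfl fun k _ => Finset.sum_comm
  calc _ = ∑ i : A, ∑ j : A, ∑ k, ∑ l, ∑ m, ∑ n, W i j k l * W j i m n *
      b (Matrix.single k l 1) (Matrix.single m n 1) := by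
        simp only [← bilin_apply_eq_sum, W]
    _ = ∑ k, ∑ l, ∑ m, ∑ n, ∑ i : A, ∑ j : A, W i j k l * W j i m n *
      b (Matrix.single k l 1) (Matrix.single m n 1) := by
        rw [h3]; refine Finset.sum_congr rfl fun k _ => ?_
        rw [h3]; refine Finset.sum_congr rfl fun l _ => ?_
        rw [h3]; refine Finset.sum_congr rfl fun m _ => ?_
        rw [h3]
    _ = _ := by
        simp only [← Finset.sum_mul, h2]
        simp

theorem posSemidef_single (i : A) : (Matrix.single i i (1 : ℂ)).PosSemidef := by
  have := Matrix.posSemidef_self_mul_conjTranspose (Matrix.single i i (1 : ℂ))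
  simpa using this

/-- The second moments of the Haar measure, in terms of a bilinear form `b`. -/
theorem exists_integral_bilin_conj_eq [Nonempty A]
    (b : Matrix A A ℂ →ₗ[ℂ] Matrix A A ℂ →ₗ[ℂ] ℂ) :
    ∃ α β : ℂ,
      (∀ X Y, ∫ U : Matrix.unitaryGroup A ℂ, b ((U : Matrix A A ℂ) * X * (U : Matrix A A ℂ)ᴴ)
        ((U : Matrix A A ℂ) * Y * (U : Matrix A A ℂ)ᴴ) ∂(unitaryHaar A)
          = α * (X.trace * Y.trace) + β * (X * Y).trace) ∧
      b 1 1 = α * Fintype.card A ^ 2 + β * Fintype.card A ∧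
      ∑ i, ∑ j, b (Matrix.single i j 1) (Matrix.single j i 1)
        = α * Fintype.card A + β * Fintype.card A ^ 2 ∧
      ((∀ P Q, P.PosSemidef → Q.PosSemidef → 0 ≤ b P Q) → (∀ X, 0 ≤ b X Xᴴ) → 0 ≤ α ∧ 0 ≤ β) := by
  obtain ⟨α, β, h, hpos⟩ := exists_eq_trace_mul_trace_add_trace_mul (twirl b)
    fun V hV X Y => twirl_conj b hV X Y
  refine ⟨α, β, h, ?_, ?_, ?_⟩
  · have h1 := h 1 1
    have h2 : ∀ U : Matrix.unitaryGroup A ℂ, (U : Matrix A A ℂ) * (U : Matrix A A ℂ)ᴴ = 1 :=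
      fun U => Matrix.mem_unitaryGroup_iff.mp U.2
    rw [twirl_apply] at h1
    simp only [Matrix.mul_one, h2, integral_const, probReal_univ, one_smul, Matrix.trace_one] at h1
    rw [h1, sq]
  · have h1 : ∑ i, ∑ j, twirl b (Matrix.single i j 1) (Matrix.single j i 1) =
        ∑ i, ∑ j, b (Matrix.single i j 1) (Matrix.single j i 1) := by
      simp only [twirl_apply]
      have : ∀ i : A, ∑ j : A, ∫ U : Matrix.unitaryGroup A ℂ,
          b ((U : Matrix A A ℂ) * Matrix.single i j 1 * (U : Matrix A A ℂ)ᴴ)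
          ((U : Matrix A A ℂ) * Matrix.single j i 1 * (U : Matrix A A ℂ)ᴴ) ∂(unitaryHaar A) =
          ∫ U : Matrix.unitaryGroup A ℂ, ∑ j : A,
          b ((U : Matrix A A ℂ) * Matrix.single i j 1 * (U : Matrix A A ℂ)ᴴ)
          ((U : Matrix A A ℂ) * Matrix.single j i 1 * (U : Matrix A A ℂ)ᴴ) ∂(unitaryHaar A) :=
        fun i => (integral_finsetSum _ fun j _ => integrable_bilin_conj b _ _).symm
      simp only [this]
      rw [← integral_finsetSum _ fun i _ => integrable_finsetSum _ fun j _ =>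
        integrable_bilin_conj b _ _]
      simp only [fun U : Matrix.unitaryGroup A ℂ => sum_bilin_single_conj b U.2, integral_const,
        probReal_univ, one_smul]
    rw [← h1]
    simp only [h, Matrix.single_mul_single_same, mul_one, Matrix.trace_single_eq_same]
    simp only [Finset.sum_add_distrib, Finset.sum_const, Finset.card_univ, nsmul_eq_mul]
    have : ∀ i : A, ∑ j : A, α * ((Matrix.single i j (1 : ℂ)).trace *
        (Matrix.single j i (1 : ℂ)).trace) = α := by
      intro i
      rw [Finset.sum_eq_single i]
      · simp
      · intro j _ hj
        rw [Matrix.trace_single_eq_of_ne _ _ _ hj.symm]; simp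
      · simp
    simp only [this, Finset.sum_const, Finset.card_univ, nsmul_eq_mul]
    ring
  · intro hP hX
    refine hpos (fun i k => ?_) (fun i k => ?_)
    · rw [twirl_apply]
      refine integral_nonneg fun U => hP _ _ ?_ ?_
      · exact (posSemidef_single i).mul_mul_conjTranspose_same _
      · exact (posSemidef_single k).mul_mul_conjTranspose_same _
    · rw [twirl_apply]
      refine integral_nonneg fun U => ?_
      have := hX ((U : Matrix A A ℂ) * Matrix.single i k 1 * (U : Matrix A A ℂ)ᴴ)
      rwa [Matrix.conjTranspose_mul, Matrix.conjTranspose_mul, Matrix.conjTranspose_conjTranspose,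
        Matrix.conjTranspose_single, star_one, ← Matrix.mul_assoc] at this

/-- The first moment of the Haar measure. -/
theorem integral_linear_conj_eq [Nonempty A] (f : Matrix A A ℂ →ₗ[ℂ] ℂ) (X : Matrix A A ℂ) :
    ∫ U : Matrix.unitaryGroup A ℂ, f ((U : Matrix A A ℂ) * X * (U : Matrix A A ℂ)ᴴ) ∂(unitaryHaar A)
      = X.trace * f ((Fintype.card A : ℂ)⁻¹ • 1) := by
  have hd : (Fintype.card A : ℂ) ≠ 0 := Nat.cast_ne_zero.mpr Fintype.card_ne_zero
  have htr : ∀ (U : Matrix.unitaryGroup A ℂ) (Y : Matrix A A ℂ),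
      ((U : Matrix A A ℂ) * Y * (U : Matrix A A ℂ)ᴴ).trace = Y.trace := by
    intro U Y
    rw [Matrix.trace_mul_comm, ← Matrix.mul_assoc,
      show (U : Matrix A A ℂ)ᴴ * (U : Matrix A A ℂ) = 1 from Matrix.mem_unitaryGroup_iff'.mp U.2,
      Matrix.one_mul]
  let b : Matrix A A ℂ →ₗ[ℂ] Matrix A A ℂ →ₗ[ℂ] ℂ :=
    LinearMap.mk₂ ℂ (fun X Y => f X * Y.trace) (by intros; simp [add_mul])
      (by intros; simp [mul_assoc]) (by intros; simp [mul_add]) (by intros; simp; ring)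
  obtain ⟨α, β, h, h1, -⟩ := exists_integral_bilin_conj_eq b
  have h2 := h X 1
  simp only [b, LinearMap.mk₂_apply, htr] at h2
  simp only [b, LinearMap.mk₂_apply, Matrix.trace_one] at h1
  rw [integral_mul_const, Matrix.mul_one, Matrix.trace_one] at h2
  rw [map_smul, smul_eq_mul]
  apply mul_right_cancel₀ hd
  rw [h2]
  have h3 : f 1 = α * Fintype.card A + β := by
    apply mul_right_cancel₀ hd
    rw [h1]; ring
  rw [h3]
  field_simp

end HaarAverages

/-! ### Choi operators and the deviation from a decoupled state -/

section Choi
variable {A E R : Type*} [Fintype A] [DecidableEq A] [Fintype E] [DecidableEq E]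
  [Fintype R] [DecidableEq R]

/-- The `(r, s)` block of an operator on `AR`, which is an operator on `A`. -/
def block (X : Matrix (A × R) (A × R) ℂ) (r s : R) : Matrix A A ℂ :=
  Matrix.of fun a b => X (a, r) (b, s)

theorem block_apply (X : Matrix (A × R) (A × R) ℂ) (r s : R) (a b : A) :
    block X r s a b = X (a, r) (b, s) := rfl

theorem block_conjFst (U : Matrix A A ℂ) (X : Matrix (A × R) (A × R) ℂ) (r s : R) :
    block (conjFst U X) r s = U * block X r s * Uᴴ := by
  ext a b
  simp [block, conjFst, Matrix.mul_apply, Fintype.sum_prod_type, Matrix.one_apply,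
    Finset.sum_mul, apply_ite (starRingEnd ℂ)]

theorem trace_eq_sum_trace_block (X : Matrix (A × R) (A × R) ℂ) :
    X.trace = ∑ r, (block X r r).trace := by
  simp only [Matrix.trace, Fintype.sum_prod_type, Matrix.diag_apply, block_apply]
  exact Finset.sum_comm

theorem trace_mul_eq_sum_block (X Y : Matrix (A × R) (A × R) ℂ) :
    (X * Y).trace = ∑ r, ∑ s, (block X r s * block Y s r).trace := by
  rw [trace_eq_sum_trace_block]
  refine Finset.sum_congr rfl fun r _ => ?_
  rw [← Matrix.trace_sum]
  congr 1
  ext a b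
  simp only [block_apply, Matrix.mul_apply, Fintype.sum_prod_type, Matrix.sum_apply]
  exact Finset.sum_comm

theorem traceFst_apply (X : Matrix (A × R) (A × R) ℂ) (r s : R) :
    traceFst X r s = (block X r s).trace := rfl

theorem trace_traceFst (X : Matrix (A × R) (A × R) ℂ) : (traceFst X).trace = X.trace := by
  rw [trace_eq_sum_trace_block]; rfl

/-- The linear map with Choi operator `ω`, in the normalisation of `choiState`. -/
def ofChoi (ω : Matrix (A × E) (A × E) ℂ) : Matrix A A ℂ →ₗ[ℂ] Matrix E E ℂ where
  toFun X := (Fintype.card A : ℂ) • Matrix.of fun e e' => ∑ i, ∑ j, X i j * ω (i, e) (j, e')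
  map_add' X Y := by
    rw [← smul_add]
    congr 1
    ext e e'
    simp [add_mul, Finset.sum_add_distrib]
  map_smul' c X := by
    rw [smul_comm]
    congr 1
    ext e e'
    simp [mul_assoc, Finset.mul_sum]

theorem ofChoi_apply (ω : Matrix (A × E) (A × E) ℂ) (X : Matrix A A ℂ) (e e' : E) :
    ofChoi ω X e e' = Fintype.card A * ∑ i, ∑ j, X i j * ω (i, e) (j, e') := rfl

theorem choiState_apply (T : Matrix A A ℂ →ₗ[ℂ] Matrix E E ℂ) (i j : A) (e e' : E) :
    choiState T (i, e) (j, e') = (Fintype.card A : ℂ)⁻¹ * T (Matrix.single i j 1) e e' := by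
  have h : (Matrix.of fun a b => maxEntangled A (a, i) (b, j)) =
      (Fintype.card A : ℂ)⁻¹ • Matrix.single i j (1 : ℂ) := by
    ext a b
    have hs : ((Real.sqrt (Fintype.card A))⁻¹ : ℂ) * ((Real.sqrt (Fintype.card A))⁻¹ : ℂ) =
        (Fintype.card A : ℂ)⁻¹ := by
      rw [← mul_inv, ← Complex.ofReal_mul, Real.mul_self_sqrt (Nat.cast_nonneg _)]
      simp
    simp only [maxEntangled, Matrix.of_apply, Matrix.vecMulVec_apply, maxEntangledVec,
      Pi.star_apply, Matrix.smul_apply, Matrix.single_apply, smul_eq_mul]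
    by_cases h1 : a = i <;> by_cases h2 : b = j
    · simp [h1, h2, hs]
    · simp [h1, h2, Ne.symm h2]
    · simp [h1, h2, Ne.symm h1]
    · simp [h1, h2, Ne.symm h1]
  simp only [choiState, Matrix.submatrix_apply, Prod.swap_prod_mk, applyFst, Matrix.of_apply]
  rw [h, map_smul]
  rfl

theorem ofChoi_choiState [Nonempty A] (T : Matrix A A ℂ →ₗ[ℂ] Matrix E E ℂ) :
    ofChoi (choiState T) = T := by
  have hd : (Fintype.card A : ℂ) ≠ 0 := Nat.cast_ne_zero.mpr Fintype.card_ne_zero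
  ext1 X
  ext e e'
  conv_rhs => rw [eq_sum_smul_single X]
  simp only [ofChoi_apply, choiState_apply, map_sum, map_smul, Matrix.sum_apply,
    Matrix.smul_apply, smul_eq_mul, Finset.mul_sum]
  refine Finset.sum_congr rfl fun i _ => Finset.sum_congr rfl fun j _ => ?_
  field_simp

theorem ofChoi_smul_one [Nonempty A] (ω : Matrix (A × E) (A × E) ℂ) :
    ofChoi ω ((Fintype.card A : ℂ)⁻¹ • 1) = traceFst ω := by
  have hd : (Fintype.card A : ℂ) ≠ 0 := Nat.cast_ne_zero.mpr Fintype.card_ne_zero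
  ext e e'
  simp [ofChoi_apply, traceFst, Matrix.one_apply, ← Finset.mul_sum, hd]

theorem ofChoi_single (ω : Matrix (A × E) (A × E) ℂ) (i j : A) (e e' : E) :
    ofChoi ω (Matrix.single i j 1) e e' = Fintype.card A * ω (i, e) (j, e') := by
  simp [ofChoi_apply, Matrix.single_apply, ite_and]

theorem ofChoi_conjTranspose {ω : Matrix (A × E) (A × E) ℂ} (hω : ω.IsHermitian)
    (X : Matrix A A ℂ) : ofChoi ω Xᴴ = (ofChoi ω X)ᴴ := by
  ext e e'
  rw [Matrix.conjTranspose_apply, ofChoi_apply, ofChoi_apply, Finset.sum_comm]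
  simp only [star_mul', star_sum, star_natCast, Matrix.conjTranspose_apply]
  simp_rw [hω.apply]

theorem applyFst_apply (T : Matrix A A ℂ →ₗ[ℂ] Matrix E E ℂ) (X : Matrix (A × R) (A × R) ℂ)
    (e e' : E) (r s : R) : applyFst T X (e, r) (e', s) = T (block X r s) e e' := rfl

/-- The operator obtained from positive semidefinite `ω` and `X` is a compression of `X ⊗ ω`, and
so positive semidefinite. -/
theorem posSemidef_applyFst_ofChoi {ω : Matrix (A × E) (A × E) ℂ} (hω : ω.PosSemidef)
    {X : Matrix (A × R) (A × R) ℂ} (hX : X.PosSemidef) :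
    (applyFst (ofChoi ω) X).PosSemidef := by
  let V : Matrix ((A × R) × (A × E)) (E × R) ℂ :=
    Matrix.of fun p q => if p.1.1 = p.2.1 ∧ p.2.2 = q.1 ∧ p.1.2 = q.2 then 1 else 0
  have hV : applyFst (ofChoi ω) X = (Fintype.card A : ℂ) • (Vᴴ * (X ⊗ₖ ω) * V) := by
    ext ⟨e, r⟩ ⟨e', s⟩
    rw [applyFst_apply, ofChoi_apply, Matrix.smul_apply, smul_eq_mul]
    congr 1
    simp only [V, Matrix.mul_apply, Fintype.sum_prod_type, Matrix.conjTranspose_apply,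
      Matrix.of_apply, Matrix.kroneckerMap_apply, block_apply, apply_ite star, star_one,
      star_zero, ite_and, ite_mul, one_mul, zero_mul, mul_ite, mul_one, mul_zero]
    simp
    exact Finset.sum_comm
  rw [hV]
  exact ((hX.kronecker hω).conjTranspose_mul_mul_same V).smul (Nat.cast_nonneg _)

theorem trace_mul_nonneg {P Q : Matrix E E ℂ} (hP : P.PosSemidef) (hQ : Q.PosSemidef) :
    0 ≤ (P * Q).trace := by
  have hb : (CFC.sqrt Q)ᴴ = CFC.sqrt Q := (CFC.sqrt_nonneg Q).isSelfAdjoint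
  have h := (hP.conjTranspose_mul_mul_same (CFC.sqrt Q)).trace_nonneg
  rwa [hb, Matrix.trace_mul_comm, ← Matrix.mul_assoc, CFC.sqrt_mul_sqrt_self Q hQ.nonneg,
    Matrix.trace_mul_comm] at h

theorem posSemidef_ofChoi {ω : Matrix (A × E) (A × E) ℂ} (hω : ω.PosSemidef)
    {X : Matrix A A ℂ} (hX : X.PosSemidef) : (ofChoi ω X).PosSemidef := by
  have h := posSemidef_applyFst_ofChoi (R := Unit) hω (hX.submatrix Prod.fst)
  exact h.submatrix fun e => (e, ())

theorem posSemidef_traceFst {X : Matrix (A × R) (A × R) ℂ} (hX : X.PosSemidef) :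
    (traceFst X).PosSemidef := by
  have : traceFst X = ∑ a, X.submatrix (fun r => (a, r)) (fun r => (a, r)) := by
    ext r s
    simp [traceFst, Matrix.sum_apply]
  rw [this]
  exact Matrix.posSemidef_sum _ fun a _ => hX.submatrix _

/-- The deviation `T(U · X) - ω^E ⊗ X^R` from a decoupled state, where `T` is the map with Choi
operator `ω`. -/
def deviation (ω : Matrix (A × E) (A × E) ℂ) (X : Matrix (A × R) (A × R) ℂ) (U : Matrix A A ℂ) :
    Matrix (E × R) (E × R) ℂ :=
  applyFst (ofChoi ω) (conjFst U X) - traceFst ω ⊗ₖ traceFst X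

theorem block_deviation (ω : Matrix (A × E) (A × E) ℂ) (X : Matrix (A × R) (A × R) ℂ)
    (U : Matrix A A ℂ) (r s : R) :
    block (deviation ω X U) r s =
      ofChoi ω (U * block X r s * Uᴴ) - (block X r s).trace • traceFst ω := by
  ext e e'
  simp only [block_apply, deviation, Matrix.sub_apply, applyFst_apply, block_conjFst,
    Matrix.kroneckerMap_apply, traceFst_apply X, Matrix.smul_apply, smul_eq_mul, mul_comm]

end Choi

/-! ### Complete positivity and the second moment of the deviation -/

section CP
open scoped Matrix.Norms.L2Operator
variable {A E : Type*} [Fintype A] [DecidableEq A] [Fintype E] [DecidableEq E]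

/-- The Choi operator of a completely positive map is positive semidefinite: the matrix of matrix
units `(eᵢⱼ)` has the form `N† N` in the C⋆-algebra of block matrices. -/
theorem posSemidef_choiState {T : Matrix A A ℂ →ₗ[ℂ] Matrix E E ℂ}
    (hT : IsCompletelyPositive T) : (choiState T).PosSemidef := by
  obtain ⟨S, rfl⟩ := hT
  cases isEmpty_or_nonempty A with
  | inl h =>
    have : choiState S.toLinearMap = 0 := by ext ⟨a, _⟩; exact h.elim a
    rw [this]; exact Matrix.PosSemidef.zero
  | inr h =>
    obtain ⟨a₀⟩ := h
    let k := Fintype.card A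
    let φ : A ≃ Fin k := Fintype.equivFin A
    let N : CStarMatrix (Fin k) (Fin k) (Matrix A A ℂ) :=
      CStarMatrix.ofMatrix (Matrix.of fun i j =>
        if i = φ a₀ then Matrix.single a₀ (φ.symm j) 1 else 0)
    have hN := S.map_cstarMatrix_nonneg' k (star N * N) (star_mul_self_nonneg N)
    have hNe : ∀ i j, (star N * N) i j = Matrix.single (φ.symm i) (φ.symm j) (1 : ℂ) := by
      intro i j
      simp [N, CStarMatrix.mul_apply, CStarMatrix.star_apply, Matrix.star_eq_conjTranspose]
    -- the block matrix of a nonnegative element of the C⋆-algebra is positive semidefinite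
    have key : ∀ M : CStarMatrix (Fin k) (Fin k) (Matrix E E ℂ), 0 ≤ M →
        (Matrix.of fun (p q : A × E) => M (φ p.1) (φ q.1) p.2 q.2).PosSemidef := by
      intro M hM
      rw [StarOrderedRing.nonneg_iff] at hM
      induction hM using AddSubmonoid.closure_induction with
      | mem M hM =>
        obtain ⟨L, rfl⟩ := hM
        let V : Matrix (Fin k × E) (A × E) ℂ := Matrix.of fun p q => L p.1 (φ q.1) p.2 q.2
        convert Matrix.posSemidef_conjTranspose_mul_self V using 1
        ext ⟨i, e⟩ ⟨j, e'⟩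
        simp [V, Matrix.mul_apply, Matrix.sum_apply, Fintype.sum_prod_type, CStarMatrix.mul_apply,
          CStarMatrix.star_apply]
      | zero => exact Matrix.PosSemidef.zero
      | add M M' _ _ h h' => exact h.add h'
    have hV : choiState S.toLinearMap = (Fintype.card A : ℂ)⁻¹ • (Matrix.of fun (p q : A × E) =>
        ((star N * N).map S.toLinearMap) (φ p.1) (φ q.1) p.2 q.2) := by
      ext ⟨i, e⟩ ⟨j, e'⟩
      rw [choiState_apply, Matrix.smul_apply, Matrix.of_apply, CStarMatrix.map_apply, hNe]
      simp
    rw [hV]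
    refine (key _ hN).smul ?_
    rw [← Complex.ofReal_natCast, ← Complex.ofReal_inv]
    exact Complex.zero_le_real.mpr (by positivity)

end CP

section SecondMoment
variable {A E R : Type*} [Fintype A] [DecidableEq A] [Fintype E] [DecidableEq E]
  [Fintype R] [DecidableEq R]

theorem sum_trace_ofChoi_single (ω : Matrix (A × E) (A × E) ℂ) :
    ∑ i, ∑ j, (ofChoi ω (Matrix.single i j 1) * ofChoi ω (Matrix.single j i 1)).trace =
      (Fintype.card A : ℂ) ^ 2 * (ω * ω).trace := by
  simp only [Matrix.trace, Matrix.diag_apply, Matrix.mul_apply, ofChoi_single,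
    Fintype.sum_prod_type, Finset.mul_sum]
  refine Finset.sum_congr rfl fun i _ => ?_
  rw [Finset.sum_comm]
  refine Finset.sum_congr rfl fun e _ => Finset.sum_congr rfl fun j _ =>
    Finset.sum_congr rfl fun e' _ => ?_
  ring

theorem continuous_linear_conj (f : Matrix A A ℂ →ₗ[ℂ] ℂ) (X : Matrix A A ℂ) :
    Continuous fun U : Matrix.unitaryGroup A ℂ =>
      f ((U : Matrix A A ℂ) * X * (U : Matrix A A ℂ)ᴴ) := by
  have hf : Continuous f := f.continuous_of_finiteDimensional
  fun_prop

/-- The Hilbert–Schmidt form of decoupling. The Haar average of the form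
`tr (T (U X U†) T (U Y U†))` is `α tr X tr Y + β tr (X Y)` with `α, β ≥ 0`, and dropping the
subleading terms in `α` and `β` leaves the product of the purities of `ω` and `X`. -/
theorem integral_trace_deviation_sq_le [Nonempty A] {ω : Matrix (A × E) (A × E) ℂ}
    (hω : ω.PosSemidef) {X : Matrix (A × R) (A × R) ℂ} (hX : X.PosSemidef) :
    ∫ U : Matrix.unitaryGroup A ℂ, (deviation ω X (U : Matrix A A ℂ) *
        deviation ω X (U : Matrix A A ℂ)).trace ∂(unitaryHaar A)
      ≤ (ω * ω).trace * (X * X).trace := by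
  have hd : (Fintype.card A : ℂ) ≠ 0 := Nat.cast_ne_zero.mpr Fintype.card_ne_zero
  set d : ℂ := (Fintype.card A : ℂ) with hdd
  have hd0 : (0 : ℂ) ≤ d⁻¹ := by
    rw [hdd, ← Complex.ofReal_natCast, ← Complex.ofReal_inv]
    exact Complex.zero_le_real.mpr (by positivity)
  set T := ofChoi ω with hT
  set τ := traceFst ω with hτ
  have hτT : T (d⁻¹ • 1) = τ := ofChoi_smul_one ω
  let b : Matrix A A ℂ →ₗ[ℂ] Matrix A A ℂ →ₗ[ℂ] ℂ :=
    LinearMap.mk₂ ℂ (fun X Y => (T X * T Y).trace) (by intros; simp [add_mul])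
      (by intros; simp) (by intros; simp [mul_add]) (by intros; simp)
  let f : Matrix A A ℂ →ₗ[ℂ] ℂ :=
    { toFun := fun X => (T X * τ).trace
      map_add' := by intros; simp [add_mul]
      map_smul' := by intros; simp }
  obtain ⟨α, β, hint, h11, hcas, hpos⟩ := exists_integral_bilin_conj_eq b
  obtain ⟨hα, hβ⟩ := hpos
    (fun P Q hP hQ => trace_mul_nonneg (posSemidef_ofChoi hω hP) (posSemidef_ofChoi hω hQ))
    (fun Y => by
      simp only [b, LinearMap.mk₂_apply, hT, ofChoi_conjTranspose hω.isHermitian]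
      exact (Matrix.posSemidef_self_mul_conjTranspose _).trace_nonneg)
  set x := (τ * τ).trace with hx
  set y := (ω * ω).trace with hy
  have hbx : b 1 1 = d ^ 2 * x := by
    have : T 1 = d • τ := by rw [← hτT, map_smul, smul_inv_smul₀ hd]
    simp only [b, LinearMap.mk₂_apply, this, Matrix.smul_mul, Matrix.mul_smul, Matrix.trace_smul,
      smul_eq_mul, hx]
    ring
  have hby : ∑ i, ∑ j, b (Matrix.single i j 1) (Matrix.single j i 1) = d ^ 2 * y :=
    sum_trace_ofChoi_single ω
  rw [hbx] at h11
  rw [hby] at hcas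
  -- `h11` and `hcas` express that the average preserves the values of `b` at `1 ⊗ 1` and at the
  -- Casimir tensor; the coefficients fall short of `x` and `y` by nonnegative amounts
  have hαx : α = x - β * d⁻¹ := by
    field_simp
    apply mul_left_cancel₀ hd
    linear_combination -h11
  have hβy : β = y - α * d⁻¹ := by
    field_simp
    apply mul_left_cancel₀ hd
    linear_combination -hcas
  have hf : ∀ Y, ∫ U : Matrix.unitaryGroup A ℂ,
      f ((U : Matrix A A ℂ) * Y * (U : Matrix A A ℂ)ᴴ) ∂(unitaryHaar A) = Y.trace * x := by
    intro Y
    rw [integral_linear_conj_eq f Y]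
    simp only [f, LinearMap.coe_mk, AddHom.coe_mk]
    rw [← hdd, hτT]
  have hfi : ∀ Y, Integrable (fun U : Matrix.unitaryGroup A ℂ =>
      f ((U : Matrix A A ℂ) * Y * (U : Matrix A A ℂ)ᴴ)) (unitaryHaar A) :=
    fun Y => integrable_of_continuous (continuous_linear_conj f Y)
  have hpt : ∀ (U : Matrix.unitaryGroup A ℂ) (r s : R),
      (block (deviation ω X (U : Matrix A A ℂ)) r s *
        block (deviation ω X (U : Matrix A A ℂ)) s r).trace =
      b ((U : Matrix A A ℂ) * block X r s * (U : Matrix A A ℂ)ᴴ)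
        ((U : Matrix A A ℂ) * block X s r * (U : Matrix A A ℂ)ᴴ)
      - (block X s r).trace * f ((U : Matrix A A ℂ) * block X r s * (U : Matrix A A ℂ)ᴴ)
      - (block X r s).trace * f ((U : Matrix A A ℂ) * block X s r * (U : Matrix A A ℂ)ᴴ)
      + (block X r s).trace * (block X s r).trace * x := by
    intro U r s
    simp only [block_deviation, b, f, LinearMap.mk₂_apply, LinearMap.coe_mk, AddHom.coe_mk,
      Matrix.sub_mul, Matrix.mul_sub, Matrix.smul_mul, Matrix.mul_smul, Matrix.trace_sub,
      Matrix.trace_smul, smul_eq_mul, ← hT, ← hτ, hx]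
    rw [Matrix.trace_mul_comm τ (T _)]
    ring
  have hrs : ∀ r s : R, ∫ U : Matrix.unitaryGroup A ℂ,
      (block (deviation ω X (U : Matrix A A ℂ)) r s *
        block (deviation ω X (U : Matrix A A ℂ)) s r).trace ∂(unitaryHaar A) =
      (α - x) * ((block X r s).trace * (block X s r).trace)
        + β * (block X r s * block X s r).trace := by
    intro r s
    have i1 := integrable_bilin_conj b (block X r s) (block X s r)
    have i2 := (hfi (block X r s)).const_mul (block X s r).trace
    have i3 := (hfi (block X s r)).const_mul (block X r s).trace
    simp only [hpt]
    rw [integral_add, integral_sub, integral_sub i1 i2, integral_const_mul,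
      integral_const_mul, hf, hf, hint, integral_const, probReal_univ, one_smul]
    · ring
    · exact i1.sub i2
    · exact i3
    · exact (i1.sub i2).sub i3
    · exact integrable_const _
  have hrsi : ∀ r s : R, Integrable (fun U : Matrix.unitaryGroup A ℂ =>
      (block (deviation ω X (U : Matrix A A ℂ)) r s *
        block (deviation ω X (U : Matrix A A ℂ)) s r).trace) (unitaryHaar A) := by
    intro r s
    simp only [hpt]
    exact (((integrable_bilin_conj b _ _).sub ((hfi _).const_mul _)).sub
      ((hfi _).const_mul _)).add (integrable_const _)
  simp only [trace_mul_eq_sum_block (deviation ω X _)]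
  rw [integral_finsetSum _ fun r _ => integrable_finsetSum _ fun s _ => hrsi r s]
  simp only [fun r => integral_finsetSum (μ := unitaryHaar A) Finset.univ
    fun s _ => hrsi r s, hrs, Finset.sum_add_distrib, ← Finset.mul_sum]
  rw [← trace_mul_eq_sum_block]
  have hr : ∑ r, ∑ s, (block X r s).trace * (block X s r).trace =
      (traceFst X * traceFst X).trace := by
    simp [Matrix.trace, Matrix.mul_apply, traceFst, block]
  rw [hr]
  have hr0 := trace_mul_nonneg (posSemidef_traceFst hX) (posSemidef_traceFst hX)
  have hs0 := trace_mul_nonneg hX hX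
  rw [← sub_nonneg]
  have : y * (X * X).trace - ((α - x) * (traceFst X * traceFst X).trace + β * (X * X).trace)
      = d⁻¹ * (β * (traceFst X * traceFst X).trace + α * (X * X).trace) := by
    linear_combination (-(traceFst X * traceFst X).trace) * hαx - (X * X).trace * hβy
  rw [this]
  exact mul_nonneg hd0 (add_nonneg (mul_nonneg hβ hr0) (mul_nonneg hα hs0))

end SecondMoment

/-! ### Weights and first-moment bounds -/

section Weights
variable {A B E R : Type*} [Fintype A] [DecidableEq A] [Fintype B] [DecidableEq B]
  [Fintype E] [DecidableEq E] [Fintype R] [DecidableEq R]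

/-- The operator `(1 ⊗ p) X (1 ⊗ p)`. -/
def conjSnd (p : Matrix B B ℂ) (X : Matrix (A × B) (A × B) ℂ) : Matrix (A × B) (A × B) ℂ :=
  ((1 : Matrix A A ℂ) ⊗ₖ p) * X * ((1 : Matrix A A ℂ) ⊗ₖ p)

theorem posSemidef_conjSnd {p : Matrix B B ℂ} (hp : p.IsHermitian)
    {X : Matrix (A × B) (A × B) ℂ} (hX : X.PosSemidef) : (conjSnd p X).PosSemidef := by
  have h := hX.mul_mul_conjTranspose_same ((1 : Matrix A A ℂ) ⊗ₖ p)
  rwa [Matrix.conjTranspose_kronecker, hp.eq, Matrix.conjTranspose_one] at h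

/-- The fourth root of a positive definite matrix `σ` and its inverse `p`, which carries the
weight `σ^{-1/2}` of the conditional entropy. -/
theorem exists_fourthRoot (A : Type*) [Fintype A] [DecidableEq A] {σ : Matrix B B ℂ}
    (hσ : σ.PosDef) :
    ∃ s p : Matrix B B ℂ, s.IsHermitian ∧ p.IsHermitian ∧ s * p = 1 ∧ s * s * (s * s) = σ ∧
      ((1 : Matrix A A ℂ) ⊗ₖ σ) ^ (-(1 / 2) : ℝ) = (1 : Matrix A A ℂ) ⊗ₖ (p * p) := by
  have hu : IsUnit σ := hσ.isUnit
  have h0 : 0 ≤ σ := hσ.posSemidef.nonneg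
  have hsp : IsStrictlyPositive σ := hσ.isStrictlyPositive
  have hss : σ ^ (1 / 4 : ℝ) * σ ^ (1 / 4 : ℝ) = σ ^ (1 / 2 : ℝ) := by
    rw [← CFC.rpow_add hu]; norm_num
  have hpp : σ ^ (-(1 / 4) : ℝ) * σ ^ (-(1 / 4) : ℝ) = σ ^ (-(1 / 2) : ℝ) := by
    rw [← CFC.rpow_add hu]; norm_num
  have hs1 : σ ^ (1 / 2 : ℝ) * σ ^ (1 / 2 : ℝ) = σ := by
    rw [← CFC.rpow_add hu]; norm_num
    exact CFC.rpow_one σ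
  refine ⟨σ ^ (1 / 4 : ℝ), σ ^ (-(1 / 4) : ℝ), (CFC.rpow_nonneg (a := σ)).isSelfAdjoint,
    (CFC.rpow_nonneg (a := σ)).isSelfAdjoint, CFC.rpow_mul_rpow_neg _ hsp, ?_, ?_⟩
  · rw [hss, hs1]
  · rw [hpp]
    set τ := (1 : Matrix A A ℂ) ⊗ₖ σ with hτ
    have hτd : τ.PosDef := Matrix.PosDef.one.kronecker hσ
    have hτ0 : 0 ≤ τ := hτd.posSemidef.nonneg
    have hroot : τ ^ (1 / 2 : ℝ) = (1 : Matrix A A ℂ) ⊗ₖ (σ ^ (1 / 2 : ℝ)) := by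
      rw [← CFC.sqrt_eq_rpow]
      refine CFC.sqrt_unique ?_ ?_
      · rw [← Matrix.mul_kronecker_mul, hs1, Matrix.one_mul]
      · exact (Matrix.PosSemidef.one.kronecker
          (Matrix.nonneg_iff_posSemidef.mp CFC.rpow_nonneg)).nonneg
    have h1 := CFC.rpow_neg_mul_rpow (a := τ) (1 / 2) hτd.isStrictlyPositive
    have h2 : τ ^ (1 / 2 : ℝ) * ((1 : Matrix A A ℂ) ⊗ₖ (σ ^ (-(1 / 2) : ℝ))) = 1 := by
      rw [hroot, ← Matrix.mul_kronecker_mul, CFC.rpow_mul_rpow_neg (a := σ) (1 / 2) hsp,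
        Matrix.one_mul, Matrix.one_kronecker_one]
    exact left_inv_eq_right_inv h1 h2

theorem trace_weighted_sq (p : Matrix B B ℂ) (X : Matrix (A × B) (A × B) ℂ) :
    ((((1 : Matrix A A ℂ) ⊗ₖ (p * p)) * X) ^ 2).trace = (conjSnd p X * conjSnd p X).trace := by
  have h : (1 : Matrix A A ℂ) ⊗ₖ (p * p) =
      ((1 : Matrix A A ℂ) ⊗ₖ p) * ((1 : Matrix A A ℂ) ⊗ₖ p) := by
    rw [← Matrix.mul_kronecker_mul, Matrix.one_mul]
  rw [h, sq, conjSnd]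
  set P := (1 : Matrix A A ℂ) ⊗ₖ p
  rw [Matrix.mul_assoc P P X, Matrix.mul_assoc P (P * X), Matrix.trace_mul_comm P]
  simp only [Matrix.mul_assoc]

theorem block_kronecker_mul_mul (p : Matrix A A ℂ) (z : Matrix R R ℂ)
    (M : Matrix (A × R) (A × R) ℂ) (r s : R) :
    block ((p ⊗ₖ z) * M * (p ⊗ₖ z)) r s =
      ∑ r', ∑ s', (z r r' * z s' s) • (p * block M r' s' * p) := by
  ext a b
  simp only [block_apply, Matrix.mul_apply, Fintype.sum_prod_type, Matrix.kroneckerMap_apply,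
    Matrix.sum_apply, Matrix.smul_apply, smul_eq_mul, Finset.sum_mul, Finset.mul_sum]
  rw [Finset.sum_comm, Finset.sum_comm (s := (Finset.univ : Finset R))
    (t := (Finset.univ : Finset R))]
  refine Finset.sum_congr rfl fun s' _ => ?_
  rw [Finset.sum_comm (s := (Finset.univ : Finset R))]
  refine Finset.sum_congr rfl fun c _ => ?_
  rw [Finset.sum_comm (s := (Finset.univ : Finset R))]
  refine Finset.sum_congr rfl fun c' _ => Finset.sum_congr rfl fun r' _ => ?_
  ring

theorem conjSnd_submatrix (p : Matrix E E ℂ) (ω : Matrix (A × E) (A × E) ℂ) (i j : A) :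
    (conjSnd p ω).submatrix (fun e => (i, e)) (fun e => (j, e)) =
      p * ω.submatrix (fun e => (i, e)) (fun e => (j, e)) * p := by
  ext e e'
  simp [conjSnd, Matrix.mul_apply, Fintype.sum_prod_type, Matrix.one_apply, Finset.sum_mul]

theorem ofChoi_eq_sum_submatrix (ω : Matrix (A × E) (A × E) ℂ) (X : Matrix A A ℂ) :
    ofChoi ω X = (Fintype.card A : ℂ) • ∑ i, ∑ j, X i j •
      ω.submatrix (fun e => (i, e)) (fun e => (j, e)) := by
  ext e e'
  simp [ofChoi_apply, Matrix.sum_apply]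

theorem traceFst_eq_sum_submatrix (ω : Matrix (A × E) (A × E) ℂ) :
    traceFst ω = ∑ i, ω.submatrix (fun e => (i, e)) (fun e => (i, e)) := by
  ext e e'
  simp [traceFst, Matrix.sum_apply]

theorem ofChoi_conjSnd (p : Matrix E E ℂ) (ω : Matrix (A × E) (A × E) ℂ) (X : Matrix A A ℂ) :
    ofChoi (conjSnd p ω) X = p * ofChoi ω X * p := by
  simp only [ofChoi_eq_sum_submatrix, conjSnd_submatrix, Matrix.mul_smul, Matrix.smul_mul,
    Matrix.mul_sum, Matrix.sum_mul]

theorem traceFst_conjSnd (p : Matrix E E ℂ) (ω : Matrix (A × E) (A × E) ℂ) :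
    traceFst (conjSnd p ω) = p * traceFst ω * p := by
  simp only [traceFst_eq_sum_submatrix, conjSnd_submatrix, Matrix.mul_sum, Matrix.sum_mul]

theorem block_conjSnd (z : Matrix R R ℂ) (X : Matrix (A × R) (A × R) ℂ) (r s : R) :
    block (conjSnd z X) r s = ∑ r', ∑ s', (z r r' * z s' s) • block X r' s' := by
  rw [conjSnd, block_kronecker_mul_mul]
  simp

theorem ext_block {M N : Matrix (A × R) (A × R) ℂ} (h : ∀ r s, block M r s = block N r s) :
    M = N := by
  ext ⟨a, r⟩ ⟨b, s⟩
  exact congrFun (congrFun (h r s) a) b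

/-- Weighting the deviation of `(ω, X)` by `p ⊗ z` gives the deviation of the weighted pair. -/
theorem kronecker_mul_deviation_mul (p : Matrix E E ℂ) (z : Matrix R R ℂ)
    (ω : Matrix (A × E) (A × E) ℂ) (X : Matrix (A × R) (A × R) ℂ) (U : Matrix A A ℂ) :
    (p ⊗ₖ z) * deviation ω X U * (p ⊗ₖ z) = deviation (conjSnd p ω) (conjSnd z X) U := by
  refine ext_block fun r s => ?_
  rw [block_kronecker_mul_mul, block_deviation, ofChoi_conjSnd, traceFst_conjSnd, block_conjSnd]
  simp only [block_deviation, Matrix.mul_sum, Matrix.sum_mul, map_sum, Matrix.mul_smul,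
    Matrix.smul_mul, map_smul, Matrix.mul_sub, Matrix.sub_mul, smul_sub, Finset.sum_sub_distrib,
    Matrix.trace_sum, Matrix.trace_smul, Finset.sum_smul, smul_smul, smul_eq_mul]

end Weights

section Bounds
variable {A E R : Type*} [Fintype A] [DecidableEq A] [Fintype E] [DecidableEq E]
  [Fintype R] [DecidableEq R]

theorem isHermitian_deviation {ω : Matrix (A × E) (A × E) ℂ} (hω : ω.PosSemidef)
    {X : Matrix (A × R) (A × R) ℂ} (hX : X.PosSemidef) (U : Matrix A A ℂ) :
    (deviation ω X U).IsHermitian :=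
  (posSemidef_applyFst_ofChoi hω (hX.mul_mul_conjTranspose_same _)).isHermitian.sub
    ((posSemidef_traceFst hω).kronecker (posSemidef_traceFst hX)).isHermitian

theorem traceNorm_deviation_le {ω : Matrix (A × E) (A × E) ℂ} (hω : ω.PosSemidef)
    {X : Matrix (A × R) (A × R) ℂ} (hX : X.PosSemidef) (U : Matrix A A ℂ) :
    traceNorm (deviation ω X U) ≤
      (applyFst (ofChoi ω) (conjFst U X)).trace.re + ω.trace.re * X.trace.re := by
  have h := traceNorm_sub_le
    (posSemidef_applyFst_ofChoi hω (hX.mul_mul_conjTranspose_same (U ⊗ₖ (1 : Matrix R R ℂ))))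
    ((posSemidef_traceFst hω).kronecker (posSemidef_traceFst hX))
  rw [Matrix.trace_kronecker, trace_traceFst, trace_traceFst, Complex.mul_re,
    trace_im_eq_zero hω, zero_mul, sub_zero] at h
  exact h

theorem trace_applyFst (T : Matrix A A ℂ →ₗ[ℂ] Matrix E E ℂ) (X : Matrix (A × R) (A × R) ℂ) :
    (applyFst T X).trace = ∑ r, (T (block X r r)).trace := by
  rw [trace_eq_sum_trace_block]; rfl

theorem continuous_deviation (ω : Matrix (A × E) (A × E) ℂ) (X : Matrix (A × R) (A × R) ℂ) :
    Continuous fun U : Matrix.unitaryGroup A ℂ => deviation ω X (U : Matrix A A ℂ) := by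
  have hT : Continuous (ofChoi ω) := (ofChoi ω).continuous_of_finiteDimensional
  refine continuous_matrix fun ⟨e, r⟩ ⟨e', s⟩ => ?_
  have : ∀ U : Matrix.unitaryGroup A ℂ, deviation ω X (U : Matrix A A ℂ) (e, r) (e', s) =
      (ofChoi ω ((U : Matrix A A ℂ) * block X r s * (U : Matrix A A ℂ)ᴴ)
        - (block X r s).trace • traceFst ω) e e' := by
    intro U
    rw [← block_deviation]; rfl
  simp only [this]
  refine Continuous.matrix_elem ?_ e e'
  fun_prop

theorem continuous_trace_applyFst_conjFst (ω : Matrix (A × E) (A × E) ℂ)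
    (X : Matrix (A × R) (A × R) ℂ) : Continuous fun U : Matrix.unitaryGroup A ℂ =>
      (applyFst (ofChoi ω) (conjFst (U : Matrix A A ℂ) X)).trace := by
  have hT : Continuous (ofChoi ω) := (ofChoi ω).continuous_of_finiteDimensional
  simp only [trace_applyFst, block_conjFst]
  fun_prop

/-- Depolarisation by the Haar measure, under the trace. -/
theorem integral_trace_applyFst_conjFst [Nonempty A] (ω : Matrix (A × E) (A × E) ℂ)
    (X : Matrix (A × R) (A × R) ℂ) :
    ∫ U : Matrix.unitaryGroup A ℂ, (applyFst (ofChoi ω) (conjFst (U : Matrix A A ℂ) X)).trace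
      ∂(unitaryHaar A) = ω.trace * X.trace := by
  let f : Matrix A A ℂ →ₗ[ℂ] ℂ := Matrix.traceLinearMap E ℂ ℂ ∘ₗ ofChoi ω
  have hf : ∀ Y, (ofChoi ω Y).trace = f Y := fun Y => rfl
  simp only [trace_applyFst, block_conjFst, hf]
  rw [integral_finsetSum _ fun r _ => integrable_of_continuous (continuous_linear_conj f _)]
  have h1 : f ((Fintype.card A : ℂ)⁻¹ • 1) = ω.trace := by
    rw [← hf, ofChoi_smul_one, trace_traceFst]
  rw [Finset.sum_congr rfl fun r _ => integral_linear_conj_eq f (block X r r)]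
  simp only [h1]
  rw [← Finset.sum_mul, ← trace_eq_sum_trace_block, mul_comm]

theorem integral_re_trace_applyFst_conjFst [Nonempty A] {ω : Matrix (A × E) (A × E) ℂ}
    (hω : ω.PosSemidef) (X : Matrix (A × R) (A × R) ℂ) :
    ∫ U : Matrix.unitaryGroup A ℂ, (applyFst (ofChoi ω) (conjFst (U : Matrix A A ℂ) X)).trace.re
      ∂(unitaryHaar A) = ω.trace.re * X.trace.re := by
  have h := integral_re (𝕜 := ℂ)
    (integrable_of_continuous (continuous_trace_applyFst_conjFst ω X))
  rw [integral_trace_applyFst_conjFst] at h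
  simp only [RCLike.re_eq_complex_re] at h
  rw [h, Complex.mul_re, trace_im_eq_zero hω, zero_mul, sub_zero]

theorem deviation_sub_left (ω ω' : Matrix (A × E) (A × E) ℂ) (X : Matrix (A × R) (A × R) ℂ)
    (U : Matrix A A ℂ) : deviation (ω - ω') X U = deviation ω X U - deviation ω' X U := by
  refine ext_block fun r s => ?_
  have h : ofChoi (ω - ω') = ofChoi ω - ofChoi ω' := by
    ext1 Y
    ext e e'
    simp [ofChoi_apply, mul_sub]
  have h' : traceFst (ω - ω') = traceFst ω - traceFst ω' := by
    ext e e'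
    simp [traceFst]
  change _ = block (deviation ω X U) r s - block (deviation ω' X U) r s
  rw [block_deviation, block_deviation, block_deviation, h, h', LinearMap.sub_apply, smul_sub]
  abel

theorem deviation_sub_right (ω : Matrix (A × E) (A × E) ℂ) (X X' : Matrix (A × R) (A × R) ℂ)
    (U : Matrix A A ℂ) : deviation ω (X - X') U = deviation ω X U - deviation ω X' U := by
  refine ext_block fun r s => ?_
  have h : block (X - X') r s = block X r s - block X' r s := rfl
  change _ = block (deviation ω X U) r s - block (deviation ω X' U) r s
  rw [block_deviation, block_deviation, block_deviation, h, Matrix.mul_sub, Matrix.sub_mul,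
    map_sub, Matrix.trace_sub, sub_smul]
  abel

theorem traceNorm_neg (M : Matrix E E ℂ) : traceNorm (-M) = traceNorm M := by
  rw [traceNorm_eq_trace_abs, CFC.abs_neg, traceNorm_eq_trace_abs]

end Bounds

/-! ### The smoothed bound for fixed operators -/

section Averages
variable {A E R : Type*} [Fintype A] [DecidableEq A] [Fintype E] [DecidableEq E]
  [Fintype R] [DecidableEq R]

theorem integrable_real_of_continuous {f : Matrix.unitaryGroup A ℂ → ℝ} (hf : Continuous f) :
    Integrable f (unitaryHaar A) :=
  hf.integrable_of_hasCompactSupport (HasCompactSupport.of_compactSpace f)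

theorem integral_add_of_continuous {f g : Matrix.unitaryGroup A ℂ → ℝ} (hf : Continuous f)
    (hg : Continuous g) : ∫ U, (f U + g U) ∂(unitaryHaar A) =
      ∫ U, f U ∂(unitaryHaar A) + ∫ U, g U ∂(unitaryHaar A) :=
  integral_add (integrable_real_of_continuous hf) (integrable_real_of_continuous hg)

/-- A bound on `traceNorm (deviation ω X U)` whose Haar average is `2 tr ω tr X`. -/
def deviationBound (ω : Matrix (A × E) (A × E) ℂ) (X : Matrix (A × R) (A × R) ℂ)
    (U : Matrix.unitaryGroup A ℂ) : ℝ :=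
  (applyFst (ofChoi ω) (conjFst (U : Matrix A A ℂ) X)).trace.re + ω.trace.re * X.trace.re

theorem continuous_deviationBound (ω : Matrix (A × E) (A × E) ℂ) (X : Matrix (A × R) (A × R) ℂ) :
    Continuous (deviationBound ω X) :=
  (Complex.continuous_re.comp (continuous_trace_applyFst_conjFst ω X)).add continuous_const

theorem integral_deviationBound [Nonempty A] {ω : Matrix (A × E) (A × E) ℂ} (hω : ω.PosSemidef)
    (X : Matrix (A × R) (A × R) ℂ) :
    ∫ U, deviationBound ω X U ∂(unitaryHaar A) = 2 * (ω.trace.re * X.trace.re) := by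
  have hc : Continuous fun U : Matrix.unitaryGroup A ℂ =>
      (applyFst (ofChoi ω) (conjFst (U : Matrix A A ℂ) X)).trace.re :=
    Complex.continuous_re.comp (continuous_trace_applyFst_conjFst ω X)
  unfold deviationBound
  rw [integral_add (integrable_real_of_continuous hc) (integrable_const _),
    integral_re_trace_applyFst_conjFst hω, integral_const, probReal_univ, one_smul]
  ring

theorem lintegral_ofReal_le_of_le {f h : Matrix.unitaryGroup A ℂ → ℝ} (hh : Continuous h)
    (h0 : ∀ U, 0 ≤ f U) (hfh : ∀ U, f U ≤ h U) {c : ℝ} (hc : ∫ U, h U ∂(unitaryHaar A) ≤ c) :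
    ∫⁻ U, ENNReal.ofReal (f U) ∂(unitaryHaar A) ≤ ENNReal.ofReal c := by
  calc _ ≤ ∫⁻ U, ENNReal.ofReal (h U) ∂(unitaryHaar A) :=
        lintegral_mono fun U => ENNReal.ofReal_le_ofReal (hfh U)
    _ = ENNReal.ofReal (∫ U, h U ∂(unitaryHaar A)) :=
        (ofReal_integral_eq_lintegral_ofReal (integrable_real_of_continuous hh)
          (Filter.Eventually.of_forall fun U => (h0 U).trans (hfh U))).symm
    _ ≤ _ := ENNReal.ofReal_le_ofReal hc

/-- For subnormalised operators the deviation has trace norm at most `2` on average, which settles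
the case `8ε ≥ 2` without reference to the entropies. -/
theorem lintegral_traceNorm_deviation_le_two [Nonempty A] {ω : Matrix (A × E) (A × E) ℂ}
    (hω : ω.PosSemidef) (hω1 : ω.trace.re ≤ 1) {X : Matrix (A × R) (A × R) ℂ}
    (hX : X.PosSemidef) (hX1 : X.trace.re ≤ 1) :
    ∫⁻ U : Matrix.unitaryGroup A ℂ, ENNReal.ofReal (traceNorm (deviation ω X (U : Matrix A A ℂ)))
      ∂(unitaryHaar A) ≤ ENNReal.ofReal 2 := by
  refine lintegral_ofReal_le_of_le (continuous_deviationBound ω X) (fun U => traceNorm_nonneg _)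
    (fun U => traceNorm_deviation_le hω hX _) ?_
  rw [integral_deviationBound hω]
  nlinarith [trace_re_nonneg hω, trace_re_nonneg hX]

theorem traceNorm_deviation_sq_le {ω : Matrix (A × E) (A × E) ℂ} (hω : ω.PosSemidef)
    {X : Matrix (A × R) (A × R) ℂ} (hX : X.PosSemidef) (U : Matrix A A ℂ)
    {s p : Matrix E E ℂ} (hs : s.IsHermitian) (hp : p.IsHermitian) (hsp : s * p = 1)
    (hs1 : (s * s * (s * s)).trace = 1) {s' p' : Matrix R R ℂ} (hs' : s'.IsHermitian)
    (hp' : p'.IsHermitian) (hsp' : s' * p' = 1) (hs1' : (s' * s' * (s' * s')).trace = 1) :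
    traceNorm (deviation ω X U) ^ 2 ≤
      (deviation (conjSnd p ω) (conjSnd p' X) U *
        deviation (conjSnd p ω) (conjSnd p' X) U).trace.re := by
  have hH : ∀ {a : Matrix E E ℂ} {b : Matrix R R ℂ}, a.IsHermitian → b.IsHermitian →
      (a ⊗ₖ b).IsHermitian := by
    intro a b ha hb
    rw [Matrix.IsHermitian, Matrix.conjTranspose_kronecker, ha.eq, hb.eq]
  have h := traceNorm_sq_le_weighted (isHermitian_deviation hω hX U) (hH hs hs') (hH hp hp')
    (by rw [← Matrix.mul_kronecker_mul, hsp, hsp', Matrix.one_kronecker_one])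
  rwa [← Matrix.mul_kronecker_mul, ← Matrix.mul_kronecker_mul, Matrix.trace_kronecker, hs1, hs1',
    mul_one, Complex.one_re, one_mul, kronecker_mul_deviation_mul] at h

/-- The smoothed decoupling bound in terms of the weighted purities of operators `ω'`, `X'` close
to `ω`, `X` in trace norm. -/
theorem lintegral_traceNorm_deviation_le [Nonempty A] {ω ω' : Matrix (A × E) (A × E) ℂ}
    (hω : ω.PosSemidef) (hω1 : ω.trace.re ≤ 1) (hω' : ω'.PosSemidef)
    {X X' : Matrix (A × R) (A × R) ℂ} (hX : X.PosSemidef)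
    (hX' : X'.PosSemidef) (hX1' : X'.trace.re ≤ 1) {ε : ℝ}
    (hωω' : traceNorm (ω - ω') ≤ 2 * ε) (hXX' : traceNorm (X - X') ≤ 2 * ε)
    {s p : Matrix E E ℂ} (hs : s.IsHermitian) (hp : p.IsHermitian) (hsp : s * p = 1)
    (hs1 : (s * s * (s * s)).trace = 1) {s' p' : Matrix R R ℂ} (hs' : s'.IsHermitian)
    (hp' : p'.IsHermitian) (hsp' : s' * p' = 1) (hs1' : (s' * s' * (s' * s')).trace = 1) :
    ∫⁻ U : Matrix.unitaryGroup A ℂ, ENNReal.ofReal (traceNorm (deviation ω X (U : Matrix A A ℂ)))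
      ∂(unitaryHaar A) ≤
    ENNReal.ofReal (Real.sqrt ((conjSnd p ω' * conjSnd p ω').trace.re *
      (conjSnd p' X' * conjSnd p' X').trace.re)) + ENNReal.ofReal (8 * ε) := by
  set y := (conjSnd p ω' * conjSnd p ω').trace.re with hy
  set x := (conjSnd p' X' * conjSnd p' X').trace.re with hx
  have hωt := posSemidef_conjSnd hp hω'
  have hXt := posSemidef_conjSnd hp' hX'
  have hy0 : 0 ≤ y := (Complex.nonneg_iff.mp (trace_mul_nonneg hωt hωt)).1
  have hx0 : 0 ≤ x := (Complex.nonneg_iff.mp (trace_mul_nonneg hXt hXt)).1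
  have hε : 0 ≤ ε := by linarith [traceNorm_nonneg (ω - ω')]
  let a : Matrix.unitaryGroup A ℂ → ℝ := fun U =>
    (deviation (conjSnd p ω') (conjSnd p' X') (U : Matrix A A ℂ) *
        deviation (conjSnd p ω') (conjSnd p' X') (U : Matrix A A ℂ)).trace.re
  have hac' : Continuous fun U : Matrix.unitaryGroup A ℂ =>
    (deviation (conjSnd p ω') (conjSnd p' X') (U : Matrix A A ℂ) *
        deviation (conjSnd p ω') (conjSnd p' X') (U : Matrix A A ℂ)).trace := by
    have := continuous_deviation (conjSnd p ω') (conjSnd p' X')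
    fun_prop
  have hac : Continuous a := Complex.continuous_re.comp hac'
  have hai : ∫ U, a U ∂(unitaryHaar A) ≤ y * x := by
    have h1 := integral_re (𝕜 := ℂ) (integrable_of_continuous hac')
    have h2 := (Complex.le_def.mp (integral_trace_deviation_sq_le hωt hXt)).1
    rw [Complex.mul_re, (Complex.nonneg_iff.mp (trace_mul_nonneg hωt hωt)).2.symm, zero_mul,
      sub_zero] at h2
    exact h1.le.trans h2
  obtain ⟨P, N, hP, hN, hPN, hPNt⟩ := exists_posSemidef_sub (hω.isHermitian.sub hω'.isHermitian)
  obtain ⟨P', N', hP', hN', hPN', hPNt'⟩ := exists_posSemidef_sub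
    (hX.isHermitian.sub hX'.isHermitian)
  have hpt : ∀ U : Matrix.unitaryGroup A ℂ, traceNorm (deviation ω X (U : Matrix A A ℂ)) ≤
      traceNorm (deviation ω' X' (U : Matrix A A ℂ)) + (deviationBound P X' U +
        deviationBound N X' U + (deviationBound ω P' U + deviationBound ω N' U)) := by
    intro U
    have e1 := deviation_sub_left ω ω' X' (U : Matrix A A ℂ)
    rw [hPN, deviation_sub_left] at e1
    have e2 := deviation_sub_right ω X X' (U : Matrix A A ℂ)
    rw [hPN', deviation_sub_right] at e2
    have e3 : deviation ω X (U : Matrix A A ℂ) = deviation ω' X' (U : Matrix A A ℂ) +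
        (deviation P X' (U : Matrix A A ℂ) + -deviation N X' (U : Matrix A A ℂ) +
        (deviation ω P' (U : Matrix A A ℂ) + -deviation ω N' (U : Matrix A A ℂ))) := by
      rw [← sub_eq_add_neg, ← sub_eq_add_neg, e1, e2]; abel
    have i0 := isHermitian_deviation hω' hX' (U : Matrix A A ℂ)
    have i1 := isHermitian_deviation hP hX' (U : Matrix A A ℂ)
    have i2 := (isHermitian_deviation hN hX' (U : Matrix A A ℂ)).neg
    have i3 := isHermitian_deviation hω hP' (U : Matrix A A ℂ)
    have i4 := (isHermitian_deviation hω hN' (U : Matrix A A ℂ)).neg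
    rw [e3]
    have j0 := traceNorm_add_le i0 ((i1.add i2).add (i3.add i4))
    have j1 := traceNorm_add_le (i1.add i2) (i3.add i4)
    have j2 := traceNorm_add_le i1 i2
    have j3 := traceNorm_add_le i3 i4
    rw [traceNorm_neg] at j2 j3
    have k1 := traceNorm_deviation_le hP hX' (U : Matrix A A ℂ)
    have k2 := traceNorm_deviation_le hN hX' (U : Matrix A A ℂ)
    have k3 := traceNorm_deviation_le hω hP' (U : Matrix A A ℂ)
    have k4 := traceNorm_deviation_le hω hN' (U : Matrix A A ℂ)
    unfold deviationBound
    linarith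
  -- the concavity of the square root enters through `2 √a ≤ t + a / t`, optimised in `t` below
  have hmain : ∀ t : ℝ, 0 < t → ∫⁻ U : Matrix.unitaryGroup A ℂ,
      ENNReal.ofReal (traceNorm (deviation ω X (U : Matrix A A ℂ))) ∂(unitaryHaar A) ≤
      ENNReal.ofReal ((t + y * x / t) / 2 + 8 * ε) := by
    intro t ht
    have c0 : Continuous fun U => (t + a U / t) / 2 := by fun_prop
    have c1 := continuous_deviationBound P X'
    have c2 := continuous_deviationBound N X'
    have c3 := continuous_deviationBound ω P'
    have c4 := continuous_deviationBound ω N'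
    refine lintegral_ofReal_le_of_le (h := fun U => (t + a U / t) / 2 + (deviationBound P X' U +
        deviationBound N X' U + (deviationBound ω P' U + deviationBound ω N' U)))
      (c0.add ((c1.add c2).add (c3.add c4))) (fun U => traceNorm_nonneg _) (fun U => ?_) ?_
    · have h1 := traceNorm_deviation_sq_le hω' hX' (U : Matrix A A ℂ) hs hp hsp hs1 hs' hp'
        hsp' hs1'
      have h2 : traceNorm (deviation ω' X' (U : Matrix A A ℂ)) ≤ (t + a U / t) / 2 := by
        have h3 : traceNorm (deviation ω' X' (U : Matrix A A ℂ)) ^ 2 / t ≤ a U / t :=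
          div_le_div_of_nonneg_right h1 ht.le
        have h4 : 2 * traceNorm (deviation ω' X' (U : Matrix A A ℂ)) ≤
            t + traceNorm (deviation ω' X' (U : Matrix A A ℂ)) ^ 2 / t := by
          rw [← sub_nonneg]
          have : t + traceNorm (deviation ω' X' (U : Matrix A A ℂ)) ^ 2 / t -
              2 * traceNorm (deviation ω' X' (U : Matrix A A ℂ)) =
              (t - traceNorm (deviation ω' X' (U : Matrix A A ℂ))) ^ 2 / t := by
            field_simp; ring
          rw [this]; positivity
        linarith
      linarith [hpt U]
    · have c12 : Continuous fun U => deviationBound P X' U + deviationBound N X' U := c1.add c2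
      have c34 : Continuous fun U => deviationBound ω P' U + deviationBound ω N' U := c3.add c4
      have hi : ∫ U, (t + a U / t) / 2 ∂(unitaryHaar A) =
          (t + (∫ U, a U ∂(unitaryHaar A)) / t) / 2 := by
        rw [integral_div, integral_add_of_continuous continuous_const (hac.div_const t),
          integral_div, integral_const, probReal_univ, one_smul]
      have c5 : Continuous fun U => deviationBound P X' U + deviationBound N X' U +
          (deviationBound ω P' U + deviationBound ω N' U) := c12.add c34
      rw [integral_add_of_continuous c0 c5, integral_add_of_continuous c12 c34,
        integral_add_of_continuous c1 c2, integral_add_of_continuous c3 c4,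
        integral_deviationBound hP, integral_deviationBound hN, integral_deviationBound hω,
        integral_deviationBound hω, hi]
      have h1 : (∫ U, a U ∂(unitaryHaar A)) / t ≤ y * x / t :=
        div_le_div_of_nonneg_right hai ht.le
      have h2 : (P.trace.re + N.trace.re) * X'.trace.re ≤ 2 * ε * 1 :=
        mul_le_mul (hPNt ▸ hωω') hX1' (trace_re_nonneg hX') (by linarith)
      have h3 : ω.trace.re * (P'.trace.re + N'.trace.re) ≤ 1 * (2 * ε) :=
        mul_le_mul hω1 (hPNt' ▸ hXX') (add_nonneg (trace_re_nonneg hP') (trace_re_nonneg hN'))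
          zero_le_one
      linarith
  refine ENNReal.le_of_forall_pos_le_add fun δ hδ _ => ?_
  have hδ' : (0 : ℝ) < δ := hδ
  refine (hmain (Real.sqrt (y * x) + δ) (by positivity)).trans ?_
  rw [← ENNReal.ofReal_add (Real.sqrt_nonneg _) (by linarith), ← ENNReal.ofReal_coe_nnreal,
    ← ENNReal.ofReal_add (by positivity) hδ'.le]
  refine ENNReal.ofReal_le_ofReal ?_
  have h1 : y * x / (Real.sqrt (y * x) + δ) ≤ Real.sqrt (y * x) := by
    rw [div_le_iff₀ (by positivity)]
    have := Real.mul_self_sqrt (mul_nonneg hy0 hx0)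
    nlinarith [Real.sqrt_nonneg (y * x)]
  linarith

end Averages

/-! ### Conditional entropies -/

section Entropies
variable {A B : Type*} [Fintype A] [DecidableEq A] [Fintype B] [DecidableEq B]

theorem log₂_mono {x y : ℝ≥0∞} (h : x ≤ y) : log₂ x ≤ log₂ y :=
  EReal.div_le_div_right_of_nonneg
    (EReal.coe_nonneg.mpr (Real.log_nonneg one_le_two)) (ENNReal.log_monotone h)

theorem exp₂_mono {x y : EReal} (h : x ≤ y) : exp₂ x ≤ exp₂ y :=
  EReal.exp_monotone
    (mul_le_mul_of_nonneg_right h (EReal.coe_nonneg.mpr (Real.log_nonneg one_le_two)))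

theorem exp₂_add (x y : EReal) : exp₂ (x + y) = exp₂ x * exp₂ y := by
  rw [exp₂, EReal.right_distrib_of_nonneg_of_ne_top
    (EReal.coe_nonneg.mpr (Real.log_nonneg one_le_two)) (EReal.coe_ne_top _), EReal.exp_add]
  rfl

theorem exp₂_half_mul_log₂ (x : ℝ≥0∞) :
    exp₂ (((1 / 2 : ℝ) : EReal) * log₂ x) = x ^ (1 / 2 : ℝ) := by
  have h : (Real.log 2 : EReal) ≠ 0 := by
    exact_mod_cast (Real.log_pos one_lt_two).ne'
  rw [exp₂, log₂, mul_assoc, EReal.div_mul_cancel (EReal.coe_ne_bot _) (EReal.coe_ne_top _) h,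
    ← ENNReal.log_rpow, ENNReal.exp_log]

/-- The pairs of a state `τ` in the smoothing ball and a weight `σ` over which the smooth
conditional 2-entropy is optimised. -/
def smoothingPairs (ε : ℝ) (ρ : Matrix (A × B) (A × B) ℂ) :
    Set (Matrix (A × B) (A × B) ℂ × Matrix B B ℂ) :=
  {p | p.1 ∈ smoothingBall ρ ε ∧ IsDensity p.2 ∧ p.2.PosDef}

/-- The weighted purity `tr [((1 ⊗ σ)^{-1/2} τ)²]`. -/
noncomputable def weightedPurity (τ : Matrix (A × B) (A × B) ℂ) (σ : Matrix B B ℂ) : ℝ :=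
  ((((1 : Matrix A A ℂ) ⊗ₖ σ) ^ (-(1 / 2) : ℝ) * τ) ^ 2).trace.re

/-- The optimisation over smoothing pairs bounds `2 ^ (-H₂^ε / 2)` from below. -/
theorem iInf_weightedPurity_le_exp₂ (ε : ℝ) (ρ : Matrix (A × B) (A × B) ℂ) :
    ⨅ p : smoothingPairs ε ρ, ENNReal.ofReal (weightedPurity p.1.1 p.1.2) ^ (1 / 2 : ℝ) ≤
      exp₂ (-((1 / 2 : ℝ) : EReal) * smoothCondTwoEntropy ε ρ) := by
  set I := ⨅ p : smoothingPairs ε ρ, ENNReal.ofReal (weightedPurity p.1.1 p.1.2) ^ (1 / 2 : ℝ)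
    with hI
  have hsq : ∀ x : ℝ≥0∞, (x ^ (2 : ℝ)) ^ (1 / 2 : ℝ) = x := by
    intro x; rw [← ENNReal.rpow_mul]; norm_num
  have hsq' : ∀ x : ℝ≥0∞, (x ^ (1 / 2 : ℝ)) ^ (2 : ℝ) = x := by
    intro x; rw [← ENNReal.rpow_mul]; norm_num
  have h1 : smoothCondTwoEntropy ε ρ ≤ -log₂ (I ^ (2 : ℝ)) := by
    refine iSup₂_le fun τ hτ => EReal.neg_le_neg_iff.mpr (log₂_mono ?_)
    refine le_iInf₂ fun σ hσ => ?_
    rw [← hsq' (ENNReal.ofReal _)]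
    refine ENNReal.rpow_le_rpow ?_ zero_le_two
    exact iInf_le (fun p : smoothingPairs ε ρ =>
      ENNReal.ofReal (weightedPurity p.1.1 p.1.2) ^ (1 / 2 : ℝ)) ⟨(τ, σ), hτ, hσ⟩
  calc I = exp₂ (((1 / 2 : ℝ) : EReal) * log₂ (I ^ (2 : ℝ))) := by
        rw [exp₂_half_mul_log₂, hsq]
    _ ≤ _ := by
        refine exp₂_mono ?_
        rw [EReal.neg_mul, ← mul_neg]
        exact mul_le_mul_of_nonneg_left (EReal.le_neg_of_le_neg h1)
          (EReal.coe_nonneg.mpr (by norm_num))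

theorem weightedPurity_eq {τ : Matrix (A × B) (A × B) ℂ} {σ p : Matrix B B ℂ}
    (h : ((1 : Matrix A A ℂ) ⊗ₖ σ) ^ (-(1 / 2) : ℝ) = (1 : Matrix A A ℂ) ⊗ₖ (p * p)) :
    weightedPurity τ σ = (conjSnd p τ * conjSnd p τ).trace.re := by
  rw [weightedPurity, h, trace_weighted_sq]

theorem weightedPurity_nonneg {τ : Matrix (A × B) (A × B) ℂ} (hτ : τ.PosSemidef)
    {σ : Matrix B B ℂ} (hσ : σ.PosDef) : 0 ≤ weightedPurity τ σ := by
  obtain ⟨s, p, -, hp, -, -, hq⟩ := exists_fourthRoot A hσ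
  have := posSemidef_conjSnd hp hτ
  rw [weightedPurity_eq hq]
  exact (Complex.nonneg_iff.mp (trace_mul_nonneg this this)).1

/-- The weighted purity is bounded below, so `H₂(A|B)` is at most `log |A| - 2 log tr τ`. -/
theorem trace_re_sq_le_card_mul_weightedPurity {τ : Matrix (A × B) (A × B) ℂ} (hτ : τ.PosSemidef)
    {σ : Matrix B B ℂ} (hσ : IsDensity σ) (hσp : σ.PosDef) :
    τ.trace.re ^ 2 ≤ Fintype.card A * weightedPurity τ σ := by
  obtain ⟨s, p, hs, hp, hsp, hss, hq⟩ := exists_fourthRoot A hσp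
  have hH : ∀ {b : Matrix B B ℂ}, b.IsHermitian → ((1 : Matrix A A ℂ) ⊗ₖ b).IsHermitian := by
    intro b hb
    rw [Matrix.IsHermitian, Matrix.conjTranspose_kronecker, hb.eq, Matrix.conjTranspose_one]
  have h := traceNorm_sq_le_weighted hτ.isHermitian (hH hs) (hH hp)
    (by rw [← Matrix.mul_kronecker_mul, hsp, Matrix.one_mul, Matrix.one_kronecker_one])
  rw [← Matrix.mul_kronecker_mul, ← Matrix.mul_kronecker_mul, hss, Matrix.trace_kronecker, hσ.2,
    Matrix.one_mul, Matrix.one_mul, Matrix.trace_one, mul_one, Complex.natCast_re] at h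
  rw [weightedPurity_eq hq]
  refine le_trans ?_ h
  rw [← sq_abs]
  exact pow_le_pow_left₀ (abs_nonneg _) (abs_trace_re_le_traceNorm hτ.isHermitian) 2

theorem traceNorm_sub_le_of_mem_smoothingBall {ρ σ : Matrix A A ℂ} {ε : ℝ} (hρ : ρ.PosSemidef)
    (hρ1 : ρ.trace.re ≤ 1) (hσ : σ ∈ smoothingBall ρ ε) : traceNorm (ρ - σ) ≤ 2 * ε :=
  (traceNorm_sub_le_two_mul_fidelityDist hρ hσ.1 hρ1 hσ.2.1).trans
    (mul_le_mul_of_nonneg_left hσ.2.2 zero_le_two)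

theorem exists_isDensity_posDef [Nonempty B] : ∃ σ : Matrix B B ℂ, IsDensity σ ∧ σ.PosDef := by
  have hd : (Fintype.card B : ℂ) ≠ 0 := Nat.cast_ne_zero.mpr Fintype.card_ne_zero
  have h : ((Fintype.card B : ℂ)⁻¹ • (1 : Matrix B B ℂ)).PosDef := by
    refine Matrix.PosDef.one.smul ?_
    rw [← Complex.ofReal_natCast, ← Complex.ofReal_inv]
    exact Complex.zero_lt_real.mpr (by positivity)
  exact ⟨_, ⟨h.posSemidef, by simp [hd]⟩, h⟩

end Entropies
end Decoupling

theorem mainTheorem2 {A R E : Type*} [Fintype A] [DecidableEq A] [Fintype R] [DecidableEq R]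
    [Fintype E] [DecidableEq E]
    (ρ : Matrix (A × R) (A × R) ℂ) (hρ : IsDensity ρ)
    (T : Matrix A A ℂ →ₗ[ℂ] Matrix E E ℂ) (hT : IsCompletelyPositive T)
    (hω : (choiState T).trace.re ≤ 1)
    (ε : ℝ) (hε : 0 < ε) :
    ∫⁻ U : Matrix.unitaryGroup A ℂ,
        ENNReal.ofReal
          (traceNorm (applyFst T (conjFst (U : Matrix A A ℂ) ρ)
            - traceFst (choiState T) ⊗ₖ traceFst ρ)) ∂(unitaryHaar A)
      ≤ exp₂ (-((1 / 2 : ℝ) : EReal) * smoothCondTwoEntropy ε (choiState T)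
            - ((1 / 2 : ℝ) : EReal) * smoothCondTwoEntropy ε ρ)
        + ENNReal.ofReal (8 * ε) := by
  have hAR : Nonempty (A × R) := by
    by_contra h
    have := not_nonempty_iff.mp h
    simpa [Matrix.trace] using hρ.2
  have hA : Nonempty A := hAR.map Prod.fst
  have hR : Nonempty R := hAR.map Prod.snd
  have hωp : (choiState T).PosSemidef := posSemidef_choiState hT
  have hρ1 : ρ.trace.re = 1 := by rw [hρ.2, Complex.one_re]
  set ω := choiState T with hωdef
  have hdev : ∀ U : Matrix A A ℂ, applyFst T (conjFst U ρ) - traceFst ω ⊗ₖ traceFst ρ =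
      deviation ω ρ U := by
    intro U
    rw [deviation, hωdef, ofChoi_choiState]
  simp only [hdev]
  set L := ∫⁻ U : Matrix.unitaryGroup A ℂ, ENNReal.ofReal
    (traceNorm (deviation ω ρ (U : Matrix A A ℂ))) ∂(unitaryHaar A) with hL
  have hL2 : L ≤ ENNReal.ofReal 2 :=
    lintegral_traceNorm_deviation_le_two hωp hω hρ.1 hρ1.le
  by_cases hε4 : 1 / 4 ≤ ε
  · exact hL2.trans ((ENNReal.ofReal_le_ofReal (by linarith)).trans le_add_self)
  rw [not_le] at hε4
  let f : smoothingPairs ε ω → ℝ≥0∞ :=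
    fun p => ENNReal.ofReal (weightedPurity p.1.1 p.1.2) ^ (1 / 2 : ℝ)
  let g : smoothingPairs ε ρ → ℝ≥0∞ :=
    fun p => ENNReal.ofReal (weightedPurity p.1.1 p.1.2) ^ (1 / 2 : ℝ)
  suffices h : L - ENNReal.ofReal (8 * ε) ≤ (⨅ p, f p) * ⨅ p, g p by
    rw [← tsub_le_iff_right]
    refine h.trans ?_
    rw [sub_eq_add_neg, exp₂_add, ← EReal.neg_mul]
    exact mul_le_mul' (iInf_weightedPurity_le_exp₂ ε ω) (iInf_weightedPurity_le_exp₂ ε ρ)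
  have hfg : ∀ p q, L - ENNReal.ofReal (8 * ε) ≤ f p * g q := by
    rintro ⟨⟨ω', σ⟩, hω', hσ, hσp⟩ ⟨⟨ρ', ζ⟩, hρ', hζ, hζp⟩
    obtain ⟨s, p, hs, hp, hsp, hss, hq⟩ := exists_fourthRoot A hσp
    obtain ⟨s', p', hs', hp', hsp', hss', hq'⟩ := exists_fourthRoot A hζp
    have h := lintegral_traceNorm_deviation_le hωp hω hω'.1 hρ.1 hρ'.1 hρ'.2.1
      (traceNorm_sub_le_of_mem_smoothingBall hωp hω hω')
      (traceNorm_sub_le_of_mem_smoothingBall hρ.1 hρ1.le hρ') hs hp hsp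
      (by rw [hss, hσ.2]) hs' hp' hsp'
      (by rw [hss', hζ.2])
    rw [tsub_le_iff_right]
    refine h.trans (add_le_add_left ?_ _)
    simp only [f, g]
    have h0 : 0 ≤ weightedPurity ω' σ := weightedPurity_nonneg hω'.1 hσp
    have h0' : 0 ≤ weightedPurity ρ' ζ := weightedPurity_nonneg hρ'.1 hζp
    rw [← weightedPurity_eq hq, ← weightedPurity_eq hq', Real.sqrt_eq_rpow,
      Real.mul_rpow h0 h0', ENNReal.ofReal_mul (Real.rpow_nonneg h0 _),
      ENNReal.ofReal_rpow_of_nonneg h0 (by norm_num),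
      ENNReal.ofReal_rpow_of_nonneg h0' (by norm_num)]
  -- `ε < 1 / 4` keeps the trace of every state in the ball around `ρ` above `1 / 2`
  have hgpos : ∀ q, (ENNReal.ofReal (1 / 4 / Fintype.card A)) ^ (1 / 2 : ℝ) ≤ g q := by
    rintro ⟨⟨ρ', ζ⟩, hρ', hζ, hζp⟩
    refine ENNReal.rpow_le_rpow (ENNReal.ofReal_le_ofReal ?_) (by norm_num)
    have h1 := trace_re_sq_le_card_mul_weightedPurity hρ'.1 hζ hζp
    have h2 := abs_le.mp ((abs_trace_re_le_traceNorm (hρ.1.isHermitian.sub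
      hρ'.1.isHermitian)).trans (traceNorm_sub_le_of_mem_smoothingBall hρ.1 hρ1.le hρ'))
    rw [Matrix.trace_sub, Complex.sub_re, hρ1] at h2
    rw [div_le_iff₀ (by positivity)]
    nlinarith
  obtain ⟨ζ, hζ⟩ := exists_isDensity_posDef (B := R)
  have hg : Nonempty (smoothingPairs ε ρ) := by
    refine ⟨⟨(ρ, ζ), ⟨hρ.1, hρ1.le, ?_⟩, hζ⟩⟩
    rw [fidelityDist_self_of_trace_eq_one hρ.1 hρ.2]
    exact hε.le
  have htop : ∀ x : ℝ, ENNReal.ofReal x ^ (1 / 2 : ℝ) ≠ ⊤ := fun x =>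
    ENNReal.rpow_ne_top_of_nonneg (by norm_num) ENNReal.ofReal_ne_top
  cases isEmpty_or_nonempty (smoothingPairs ε ω) with
  | inl hf =>
    -- with no admissible state the first factor is `⊤`; the second one does not vanish
    rw [iInf_of_empty, ENNReal.top_mul]
    · exact le_top
    · refine (lt_of_lt_of_le ?_ (le_iInf hgpos)).ne'
      exact ENNReal.rpow_pos (ENNReal.ofReal_pos.mpr (by positivity)) ENNReal.ofReal_ne_top
  | inr hf =>
    exact ENNReal.le_iInf_mul_iInf ⟨hf.some, htop _⟩ ⟨hg.some, htop _⟩ hfg
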